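/- Let $n\ge 0$ and let $X,Y\subset\mathbb R^n$ be non-empty, compact, connected sets, each equal to the closure of its interior. Let $h,d:[0,\infty)\to\mathbb R$ be smooth, convex and Lipschitz, with $h$ strictly increasing, $d$ non-decreasing, and $\lim_{t\downarrow0}\frac{h(t)-h(0)}t=\lim_{t\downarrow0}\frac{d(t)-d(0)}t=0$. Assume that for some $\varepsilon>0$ $$h''(z)>\varepsilon d''(z)\quad\text{and}\quad h'(z)>\varepsilon d'(z)\qquad\text{for all } 0<z\le\sup_{x\in X,\,y\in Y}|x-y|.$$ For $k\ge 0$ put $c(x,y)=h(|x-y|)$ and $m(x,y)=\exp(-k\,d(|x-y|))$ on $X\times Y$. For Borel probability measures $\mu$ on $X$ and $\nu$ on $Y$, let $\Gamma_m(\mu,\nu)$ be the set of Borel probability measures $\pi$ on $X\times Y$ with $\pi(A\times Y)=\mu(A)$ for all Borel $A\subset X$ and $$\frac{\int_{X\times B}m\,d\pi}{\int_{X\times Y}m\,d\pi}=\nu(B)\quad\text{for all Borel } B\subset Y.$$ An optimal plan is a minimizer of $\pi\mapsto\int c\,d\pi$ over $\Gamma_m(\mu,\nu)$. Then there is a constant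 $K>0$, not depending on $\mu$, $\nu$, such that for all $0\le k<K$ and all $\mu,\nu$ as above: (i) If $\mu$ is absolutely continuous with respect to Lebesgue measure and $\partial X$ is Lebesgue-null, then an optimal plan exists, and there is a measurable map $T:X\to Y$ such that every optimal plan is equal to $(\mathrm{Id},T)_\sharp\mu$; moreover $T$ is unique up to $\mu$-null sets among the measurable maps that induce an optimal plan in this way. (ii) If $\nu$ is absolutely continuous with respect to Lebesgue measure and $\partial Y$ is Lebesgue-null, then an optimal plan exists, and there is a measurable map $S:Y\to X$ such that every optimal plan is equal to $(S,\mathrm{Id})_\sharp\lambda_S$, where $\lambda_S(dy)=\frac1{Z_S}\,\frac1{m(S(y),y)}\,\nu(dy)$ and $Z_S$ is the constant that makes $\lambda_S$ a probability measure; moreover $S$ is unique up to $\nu$-null sets among the measurable maps that induce an optimal plan in this way. -/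

import Mathlib

open MeasureTheory Set Filter Topology
open scoped ENNReal NNReal ContDiff

noncomputable section

namespace NonConservativeOT

section Plans

variable {X Y : Type*} [MeasurableSpace X] [MeasurableSpace Y]

/-- `π ∈ Γ_m(μ, ν)` for a mass-change factor `m > 0`: a probability measure whose first marginal
is `μ` and for which the transported mass `B ↦ ∫_{X × B} m dπ`, divided by its total, is `ν`.
(A total of `0` or `∞` makes the quotient vanish for every `B`, which is impossible when `ν` is a
probability measure.) -/
structure IsPlan (m : X → Y → ℝ) (μ : Measure X) (ν : Measure Y) (π : Measure (X × Y)) :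
    Prop where
  isProbabilityMeasure : IsProbabilityMeasure π
  first_marginal : ∀ A : Set X, MeasurableSet A → π (A ×ˢ univ) = μ A
  second_marginal : ∀ B : Set Y, MeasurableSet B →
    (∫⁻ p in univ ×ˢ B, ENNReal.ofReal (m p.1 p.2) ∂π) / (∫⁻ p, ENNReal.ofReal (m p.1 p.2) ∂π)
      = ν B

/-- `π` is an optimal plan: it minimizes `∫ c dπ` over `Γ_m(μ, ν)`. -/
structure IsOptimalPlan (c m : X → Y → ℝ) (μ : Measure X) (ν : Measure Y)
    (π : Measure (X × Y)) : Prop where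
  isPlan : IsPlan m μ ν π
  integrable : Integrable (fun p : X × Y => c p.1 p.2) π
  minimal : ∀ π' : Measure (X × Y), IsPlan m μ ν π' →
    Integrable (fun p : X × Y => c p.1 p.2) π' → ∫ p, c p.1 p.2 ∂π ≤ ∫ p, c p.1 p.2 ∂π'

/-- `π = (Id, T)_♯ μ`. -/
def IsInducedByMap (μ : Measure X) (π : Measure (X × Y)) (T : X → Y) : Prop :=
  Measurable T ∧ π = μ.map (fun x => (x, T x))

/-- The probability measure `λ(dy) = Z⁻¹ m(S(y), y)⁻¹ ν(dy)`, `Z` being the normalization. -/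
def dualSource (m : X → Y → ℝ) (ν : Measure Y) (S : Y → X) : Measure Y :=
  (∫⁻ y, ENNReal.ofReal (1 / m (S y) y) ∂ν)⁻¹ •
    ν.withDensity (fun y => ENNReal.ofReal (1 / m (S y) y))

/-- `π = (S, Id)_♯ λ` with `λ(dy) = Z⁻¹ m(S(y), y)⁻¹ ν(dy)`. -/
def IsInducedByDualMap (m : X → Y → ℝ) (ν : Measure Y) (π : Measure (X × Y)) (S : Y → X) :
    Prop :=
  Measurable S ∧ π = (dualSource m ν S).map (fun y => (S y, y))

end Plans

/-- The cost `c(x, y) = h(|x - y|)`, for `x ∈ X` and `y ∈ Y`. -/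
def radialCost {n : ℕ} (X Y : Set (EuclideanSpace ℝ (Fin n))) (h : ℝ → ℝ) : X → Y → ℝ :=
  fun x y => h ‖(x : EuclideanSpace ℝ (Fin n)) - y‖

/-- The mass-change factor `m(x, y) = exp(-k d(|x - y|))`, for `x ∈ X` and `y ∈ Y`. -/
def expMassChange {n : ℕ} (X Y : Set (EuclideanSpace ℝ (Fin n))) (d : ℝ → ℝ) (k : ℝ) :
    X → Y → ℝ :=
  fun x y => Real.exp (-k * d ‖(x : EuclideanSpace ℝ (Fin n)) - y‖)

end NonConservativeOT

end

set_option linter.unusedSectionVars false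

/-! The proof is by linear-programming duality. The dual problem maximizes `∫ φ dμ` over continuous
pairs with `φ(x) + ψ(y) m(x,y) ≤ c(x,y)` and `∫ ψ dν ≥ 0`. Replacing a pair by its `c, m`-transforms
gives bounds and Lipschitz constants that do not depend on `μ`, `ν`, so Arzelà–Ascoli yields a
maximizer (`IsRegularCost.exists_isDualMaximizer`) in which every `x` and every `y` has a contact
point, that is, a partner at which the constraint is an equality.

No separate strong duality theorem is needed. Suppose almost every `x` has a single contact point `T
x`. Perturbing `ψ` in directions of zero `ν`-mean, the first-order condition says that `T` pushes
`m(x, T x) μ` to a multiple of `ν`, so `(Id, T)_♯ μ` is a plan. It lives on the contact set, hence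
is optimal, and every other optimal plan must live there too and therefore equals it. Perturbing `φ`
gives the mirror statement for `S` (`exists_optimal_map`, `exists_optimal_dual_map`).

There remains almost-everywhere uniqueness of contact points. Where `φ` is differentiable, its
gradient at `x` has direction `x - y` and length `P(|x - y|)` for every contact point `y ≠ x`, with
`P(r) = h'(r) + k d'(r) (h(r) - φ(x))`; equality in the constraint has removed `ψ(y)`. The splitting
`P = (h' - ε d') + d' (ε + k (h - φ(x)))` shows that `P` is positive and strictly increasing where
the last bracket is nonnegative. At a contact point that bracket is `ε + k ψ(y) m(x,y)`, so the
uniform bound on `ψ` settles the matter for small `k`. The gradient then determines `y`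
(`eq_of_radial_touching`). The argument for `ψ` uses the profile `h' e^{kd} + k d' ψ(y)`. -/

namespace NonConservativeOT

/-! ### Partial minimization over a compact space -/

section InfOver

/-- The partial minimization `w ↦ inf_z A(w, z)`. -/
noncomputable def infOver {W Z : Type*} (A : W → Z → ℝ) (w : W) : ℝ := ⨅ z, A w z

variable {W Z : Type*} [TopologicalSpace Z] [CompactSpace Z] [Nonempty Z]

theorem exists_infOver_eq {A : W → Z → ℝ} {w : W} (hA : Continuous (A w)) :
    ∃ z, A w z = infOver A w ∧ ∀ z', A w z ≤ A w z' := by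
  obtain ⟨z, -, hz⟩ := isCompact_univ.exists_isMinOn univ_nonempty hA.continuousOn
  have hz' : ∀ z', A w z ≤ A w z' := fun z' => hz (mem_univ z')
  exact ⟨z, le_antisymm (le_ciInf hz') (ciInf_le ⟨A w z, by rintro _ ⟨z', rfl⟩; exact hz' z'⟩ z), hz'⟩

theorem infOver_le {A : W → Z → ℝ} {w : W} (hA : Continuous (A w)) (z : Z) :
    infOver A w ≤ A w z := by
  obtain ⟨z₀, h₀, h₁⟩ := exists_infOver_eq hA
  exact h₀ ▸ h₁ z

/-- Compare each infimum with the other function at its own minimizer. The Lipschitz bounds of the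
transforms come from here. -/
theorem abs_infOver_sub_le {A : W → Z → ℝ} {w w' : W} (hw : Continuous (A w))
    (hw' : Continuous (A w')) {D : ℝ} (hD : ∀ z, |A w z - A w' z| ≤ D) :
    |infOver A w - infOver A w'| ≤ D := by
  obtain ⟨z, hz, -⟩ := exists_infOver_eq hw
  obtain ⟨z', hz', -⟩ := exists_infOver_eq hw'
  have h₁ := infOver_le hw z'
  have h₂ := infOver_le hw' z
  have h₃ := abs_le.1 (hD z)
  have h₄ := abs_le.1 (hD z')
  rw [abs_le]
  constructor <;> linarith

theorem continuous_infOver [TopologicalSpace W] {A : W → Z → ℝ}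
    (hA : Continuous (Function.uncurry A)) : Continuous (infOver A) := by
  have := isCompact_univ.continuous_sInf hA
  simp only [image_univ] at this
  exact this

end InfOver

/-! ### First variation of a partial minimum -/

section Perturbation

theorem integrable_of_continuous {Z : Type*} [TopologicalSpace Z] [CompactSpace Z]
    [MeasurableSpace Z] [BorelSpace Z] (κ : Measure Z) [IsFiniteMeasure κ] {f : Z → ℝ}
    (hf : Continuous f) : Integrable f κ :=
  hf.integrable_of_hasCompactSupport (HasCompactSupport.of_compactSpace f)

theorem exists_abs_le_of_continuous {Z : Type*} [TopologicalSpace Z] [CompactSpace Z]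
    {f : Z → ℝ} (hf : Continuous f) : ∃ C, 0 ≤ C ∧ ∀ z, |f z| ≤ C := by
  obtain ⟨C, hC⟩ := isCompact_univ.exists_bound_of_continuousOn hf.continuousOn
  exact ⟨max C 0, le_max_right _ _, fun z => (hC z (mem_univ z)).trans (le_max_left _ _)⟩

variable {W Z : Type*} [TopologicalSpace Z] [CompactSpace Z] [Nonempty Z]

/-- At a point with a unique minimizer `z₀`, the one-sided derivative of
`s ↦ inf_z (A(w, z) - s B(w, z))` at `0` is `-B(w, z₀)`. -/
theorem tendsto_infOver_quotient {A B : W → Z → ℝ} {w : W} (hA : Continuous (A w))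
    (hB : Continuous (B w)) {z₀ : Z} (hz₀ : ∀ z, A w z = infOver A w → z = z₀) {s : ℕ → ℝ}
    (hs : ∀ n, 0 < s n) (hs0 : Tendsto s atTop (𝓝 0)) :
    Tendsto (fun n => (infOver (fun w z => A w z - s n * B w z) w - infOver A w) / s n) atTop
      (𝓝 (-B w z₀)) := by
  obtain ⟨C, hC0, hC⟩ := exists_abs_le_of_continuous hB
  have hAs : ∀ n, Continuous ((fun w z => A w z - s n * B w z) w) := fun n => by
    simp only; fun_prop
  choose z hz _ using fun n =>
    exists_infOver_eq (A := fun w z => A w z - s n * B w z) (w := w) (hAs n)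
  obtain ⟨zm, hzm, hzm'⟩ := exists_infOver_eq hA
  obtain rfl := hz₀ zm hzm
  have hup : ∀ n, infOver (fun w z => A w z - s n * B w z) w ≤ infOver A w - s n * B w zm :=
    fun n => hzm ▸ infOver_le (A := fun w z => A w z - s n * B w z) (w := w) (hAs n) zm
  -- Minimizers of the perturbed problems almost minimize `A w`, so by compactness and uniqueness
  -- they converge to `zm`.
  have hlow : ∀ n, A w (z n) ≤ infOver A w + 2 * C * s n := fun n => by
    have h₁ := hup n
    rw [← hz n] at h₁
    have h₂ := abs_le.1 (hC (z n))
    have h₃ := abs_le.1 (hC zm)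
    nlinarith [hs n]
  have hAz : Tendsto (fun n => A w (z n)) atTop (𝓝 (infOver A w)) := by
    refine tendsto_of_tendsto_of_tendsto_of_le_of_le tendsto_const_nhds ?_
      (fun n => infOver_le hA (z n)) hlow
    simpa using (hs0.const_mul (2 * C)).const_add (infOver A w)
  have hzlim : Tendsto z atTop (𝓝 zm) := by
    refine isCompact_univ.tendsto_nhds_of_unique_mapClusterPt (by simp) fun y _ hy => hz₀ y ?_
    have h₁ : MapClusterPt (A w y) atTop (A w ∘ z) := hy.continuousAt_comp hA.continuousAt
    have h₂ : ClusterPt (A w y) (𝓝 (infOver A w)) := ClusterPt.mono h₁ hAz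
    exact eq_of_nhds_neBot h₂
  -- The quotient lies between `-B w (z n)` and `-B w zm`: test the unperturbed infimum at `z n` and
  -- the perturbed one at `zm`.
  refine tendsto_of_tendsto_of_tendsto_of_le_of_le
    ((hB.tendsto zm).comp hzlim).neg tendsto_const_nhds (fun n => ?_) (fun n => ?_)
  · have h₁ := infOver_le hA (z n)
    simp only [Function.comp]
    rw [le_div_iff₀ (hs n), ← hz n]
    linarith
  · rw [div_le_iff₀ (hs n)]
    linarith [hup n]

/-- First-order condition for a perturbation of a partial minimization. -/
theorem integral_nonneg_of_integral_infOver_le [TopologicalSpace W] [CompactSpace W]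
    [MeasurableSpace W] [BorelSpace W] (κ : Measure W) [IsFiniteMeasure κ]
    {A B : W → Z → ℝ} (hA : Continuous (Function.uncurry A))
    (hB : Continuous (Function.uncurry B)) {T : W → Z}
    (hT : ∀ᵐ w ∂κ, ∀ z, A w z = infOver A w → z = T w)
    (hle : ∀ s : ℝ, 0 < s →
      ∫ w, infOver (fun w z => A w z - s * B w z) w ∂κ ≤ ∫ w, infOver A w ∂κ) :
    0 ≤ ∫ w, B w (T w) ∂κ := by
  obtain ⟨C, hC0, hC⟩ := exists_abs_le_of_continuous hB
  have hAw : ∀ w, Continuous (A w) := fun w => hA.comp (Continuous.prodMk_right w)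
  have hBw : ∀ w, Continuous (B w) := fun w => hB.comp (Continuous.prodMk_right w)
  set s : ℕ → ℝ := fun n => 1 / ((n : ℝ) + 1) with hsdef
  have hs : ∀ n, 0 < s n := fun n => Nat.one_div_pos_of_nat
  have hs0 : Tendsto s atTop (𝓝 0) := tendsto_one_div_add_atTop_nhds_zero_nat
  have hAsc : ∀ t : ℝ, Continuous (Function.uncurry fun w z => A w z - t * B w z) :=
    fun t => hA.sub (continuous_const.mul hB)
  have hcont : ∀ t : ℝ, Continuous (infOver fun w z => A w z - t * B w z) :=
    fun t => continuous_infOver (hAsc t)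
  have hcontA := continuous_infOver hA
  have key : Tendsto (fun n => ∫ w, (infOver (fun w z => A w z - s n * B w z) w - infOver A w)
      / s n ∂κ) atTop (𝓝 (∫ w, -B w (T w) ∂κ)) := by
    -- A bound `C` for `|B|` also bounds every difference quotient, which justifies differentiation
    -- under the integral.
    refine tendsto_integral_of_dominated_convergence (fun _ => C)
      (fun n => (((hcont (s n)).sub hcontA).div_const _).aestronglyMeasurable)
      (integrable_const C) (fun n => ae_of_all _ fun w => ?_) ?_
    · obtain ⟨z₁, h₁, -⟩ := exists_infOver_eq (hAw w)
      obtain ⟨z₂, h₂, -⟩ := exists_infOver_eq (A := fun w z => A w z - s n * B w z) (w := w)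
        ((hAsc (s n)).comp (Continuous.prodMk_right w))
      have h₃ := infOver_le (hAw w) z₂
      have h₄ := infOver_le (A := fun w z => A w z - s n * B w z) (w := w)
        ((hAsc (s n)).comp (Continuous.prodMk_right w)) z₁
      have h₅ := abs_le.1 (hC (w, z₁))
      have h₆ := abs_le.1 (hC (w, z₂))
      simp only [Function.uncurry] at h₅ h₆
      rw [Real.norm_eq_abs, abs_div, abs_of_pos (hs n), div_le_iff₀ (hs n), abs_le]
      constructor <;> nlinarith [hs n]
    · filter_upwards [hT] with w hw
      exact tendsto_infOver_quotient (hAw w) (hBw w) hw hs hs0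
  have hle' : ∫ w, -B w (T w) ∂κ ≤ 0 := by
    refine le_of_tendsto key (Eventually.of_forall fun n => ?_)
    rw [integral_div, integral_sub (integrable_of_continuous κ (hcont _))
      (integrable_of_continuous κ hcontA)]
    exact div_nonpos_of_nonpos_of_nonneg (by linarith [hle (s n) (hs n)]) (hs n).le
  rw [integral_neg] at hle'
  linarith

end Perturbation

/-! ### Proportional measures, measurable selections, measures on graphs -/

section MeasureLemmas

/-- Both `η` and `-η` are admissible, so `ρ` vanishes on functions of zero `ν`-mean; apply this to
`f - ∫ f dν`. It converts the first-order condition into the marginal condition. -/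
theorem eq_smul_of_integral_nonneg {Z : Type*} [MetricSpace Z] [CompactSpace Z]
    [MeasurableSpace Z] [BorelSpace Z] (ν ρ : Measure Z) [IsProbabilityMeasure ν]
    [IsFiniteMeasure ρ]
    (h : ∀ η : Z → ℝ, Continuous η → ∫ z, η z ∂ν = 0 → 0 ≤ ∫ z, η z ∂ρ) :
    ρ = ρ univ • ν := by
  have : IsFiniteMeasure (ρ univ • ν) := Measure.smul_finite ν (measure_ne_top ρ univ)
  refine ext_of_forall_integral_eq_of_IsFiniteMeasure fun f => ?_
  have hf : Continuous f := f.continuous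
  have hfν := integrable_of_continuous ν hf
  have hfρ := integrable_of_continuous ρ hf
  have h₁ := h (fun z => f z - ∫ z, f z ∂ν) (by fun_prop)
    (by rw [integral_sub hfν (integrable_const _)]; simp)
  have h₂ := h (fun z => (∫ z, f z ∂ν) - f z) (by fun_prop)
    (by rw [integral_sub (integrable_const _) hfν]; simp)
  rw [integral_sub hfρ (integrable_const _)] at h₁
  rw [integral_sub (integrable_const _) hfρ] at h₂
  simp only [integral_const, smul_eq_mul] at h₁ h₂
  rw [integral_smul_measure, smul_eq_mul]
  simp only [Measure.real] at h₁ h₂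
  linarith

variable {W Z : Type*} [MetricSpace W] [CompactSpace W] [MeasurableSpace W] [BorelSpace W]
  [MetricSpace Z] [CompactSpace Z] [MeasurableSpace Z] [BorelSpace Z]

/-- A closed relation that is almost everywhere single-valued is a measurable map up to a null
set. -/
theorem exists_measurable_selection [Nonempty Z] (κ : Measure W) {F : Set (W × Z)}
    (hF : IsClosed F) (hex : ∀ w, ∃ z, (w, z) ∈ F)
    (huniq : ∀ᵐ w ∂κ, ∀ z z', (w, z) ∈ F → (w, z') ∈ F → z = z') :
    ∃ T : W → Z, Measurable T ∧ (∀ᵐ w ∂κ, (w, T w) ∈ F) ∧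
      ∀ᵐ w ∂κ, ∀ z, (w, z) ∈ F → z = T w := by
  classical
  choose T₀ hT₀ using hex
  set N := toMeasurable κ {w | ¬ ∀ z z', (w, z) ∈ F → (w, z') ∈ F → z = z'} with hN
  have hNmeas : MeasurableSet N := measurableSet_toMeasurable _ _
  have hNae : ∀ᵐ w ∂κ, w ∉ N := by
    rw [ae_iff]
    simp only [not_not]
    exact (measure_toMeasurable _).trans (ae_iff.1 huniq)
  have hNu : ∀ w ∉ N, ∀ z z', (w, z) ∈ F → (w, z') ∈ F → z = z' := fun w hw => by
    by_contra hcon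
    exact hw (subset_toMeasurable _ _ hcon)
  obtain ⟨z₀⟩ := ‹Nonempty Z›
  refine ⟨fun w => if w ∈ N then z₀ else T₀ w, measurable_of_isClosed fun G hG => ?_, ?_, ?_⟩
  -- Off the null set `N` the preimage of a closed `G` is the projection of a compact set, hence
  -- closed.
  · have hproj : IsClosed (Prod.fst '' (F ∩ Prod.snd ⁻¹' G)) :=
      ((hF.inter (hG.preimage continuous_snd)).isCompact.image continuous_fst).isClosed
    have heq : (fun w => if w ∈ N then z₀ else T₀ w) ⁻¹' G =
        (N ∩ {_w | z₀ ∈ G}) ∪ (Nᶜ ∩ Prod.fst '' (F ∩ Prod.snd ⁻¹' G)) := by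
      ext w
      by_cases hw : w ∈ N
      · simp [hw]
      · have : T₀ w ∈ G ↔ ∃ z, (w, z) ∈ F ∧ z ∈ G :=
          ⟨fun h => ⟨_, hT₀ w, h⟩, fun ⟨z, h₁, h₂⟩ => hNu w hw _ _ h₁ (hT₀ w) ▸ h₂⟩
        simp [hw, this]
    rw [heq]
    exact (hNmeas.inter (MeasurableSet.const _)).union (hNmeas.compl.inter hproj.measurableSet)
  · filter_upwards [hNae] with w hw
    simpa [hw] using hT₀ w
  · filter_upwards [hNae] with w hw z hz
    simpa [hw] using hNu w hw _ _ hz (hT₀ w)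

/-- A measure concentrated on a graph is induced by the map. -/
theorem eq_map_of_ae_eq {W Z : Type*} [MeasurableSpace W] [MeasurableSpace Z]
    {π : Measure (W × Z)} {κ : Measure W} (hπ : π.map Prod.fst = κ) {T : W → Z}
    (hT : Measurable T) (hae : ∀ᵐ p ∂π, p.2 = T p.1) : π = κ.map fun w => (w, T w) := by
  rw [← hπ, Measure.map_map (by fun_prop) measurable_fst]
  conv_lhs => rw [← Measure.map_id (μ := π)]
  refine Measure.map_congr ?_
  filter_upwards [hae] with p hp
  simp [← hp]

/-- Two maps inducing the same measure agree almost everywhere. -/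
theorem ae_eq_of_map_eq {W Z : Type*} [MeasurableSpace W] [MeasurableSpace Z]
    [MeasurableEq Z] {κ κ' : Measure W} {T T' : W → Z} (hT : Measurable T) (hT' : Measurable T')
    (h : (κ.map fun w => (w, T w)) = κ'.map fun w => (w, T' w)) : T' =ᵐ[κ'] T := by
  have hmeas : MeasurableSet {p : W × Z | p.2 = T p.1} :=
    measurableSet_eq_fun measurable_snd (hT.comp measurable_fst)
  have h₁ : ∀ᵐ p ∂(κ.map fun w => (w, T w)), p.2 = T p.1 := by
    rw [ae_map_iff (by fun_prop) hmeas]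
    simp
  rw [h, ae_map_iff (by fun_prop) hmeas] at h₁
  exact h₁

end MeasureLemmas
-- The dual problem: transforms, a priori bounds, existence
section DualProblem

/-- The set of `L`-Lipschitz functions with values in `[-C, C]` is compact. -/
theorem isCompact_lipschitz_bounded (Z : Type*) [MetricSpace Z] [CompactSpace Z] (C L : ℝ) :
    IsCompact {f : BoundedContinuousFunction Z ℝ |
      (∀ z, f z ∈ Icc (-C) C) ∧ ∀ z z', |f z - f z'| ≤ L * dist z z'} := by
  refine BoundedContinuousFunction.arzela_ascoli₂ (Icc (-C) C) isCompact_Icc _ ?_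
    (fun f z hf => hf.1 z) ?_
  · simp only [ofPred_and, ofPred_forall]
    have hev : ∀ z, Continuous fun f : BoundedContinuousFunction Z ℝ => f z :=
      fun z => continuous_eval_const _
    refine (isClosed_iInter fun z => isClosed_Icc.preimage (hev z)).inter
      (isClosed_iInter fun z => isClosed_iInter fun z' => ?_)
    exact isClosed_le ((hev z).sub (hev z')).abs continuous_const
  · refine Metric.equicontinuous_of_continuity_modulus (fun t => L * t) ?_ _
      fun z z' f => f.2.2 z z'
    simpa using (continuous_const_mul L).tendsto 0

theorem continuous_integral_boundedContinuousFunction {Z : Type*} [TopologicalSpace Z]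
    [MeasurableSpace Z] [BorelSpace Z] (κ : Measure Z) [IsProbabilityMeasure κ] :
    Continuous fun f : BoundedContinuousFunction Z ℝ => ∫ z, f z ∂κ := by
  refine (LipschitzWith.of_dist_le_mul (K := 1) fun f g => ?_).continuous
  rw [dist_eq_norm, dist_eq_norm, ← integral_sub (f.integrable κ) (g.integrable κ)]
  simpa using (f - g).norm_integral_le_norm κ

variable {X Y : Type*} [MetricSpace X] [MetricSpace Y]

/-- Two-sided bounds and Lipschitz bounds for a cost `c` and a mass-change factor `m`. -/
structure IsRegularCost (c m : X → Y → ℝ) (c₀ c₁ a b L : ℝ) : Prop where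
  continuous_cost : Continuous (Function.uncurry c)
  continuous_mass : Continuous (Function.uncurry m)
  le_cost : ∀ x y, c₀ ≤ c x y
  cost_le : ∀ x y, c x y ≤ c₁
  pos : 0 < a
  le_mass : ∀ x y, a ≤ m x y
  mass_le : ∀ x y, m x y ≤ b
  nonneg : 0 ≤ L
  cost_left : ∀ x x' y, |c x y - c x' y| ≤ L * dist x x'
  cost_right : ∀ x y y', |c x y - c x y'| ≤ L * dist y y'
  mass_left : ∀ x x' y, |m x y - m x' y| ≤ L * dist x x'
  mass_right : ∀ x y y', |m x y - m x y'| ≤ L * dist y y'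

/-- The constraint of the dual problem. -/
def IsFeasible (c m : X → Y → ℝ) (φ : X → ℝ) (ψ : Y → ℝ) : Prop :=
  ∀ x y, φ x + ψ y * m x y ≤ c x y

/-- The transform of a potential on `Y`. -/
noncomputable def leftTransform (c m : X → Y → ℝ) (ψ : Y → ℝ) : X → ℝ :=
  infOver fun x y => c x y - ψ y * m x y

/-- The transform of a potential on `X`. -/
noncomputable def rightTransform (c m : X → Y → ℝ) (φ : X → ℝ) : Y → ℝ :=
  infOver fun y x => (c x y - φ x) / m x y

namespace IsRegularCost

variable {c m : X → Y → ℝ} {c₀ c₁ a b L : ℝ} (hcm : IsRegularCost c m c₀ c₁ a b L)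
include hcm

theorem mass_pos (x : X) (y : Y) : 0 < m x y := hcm.pos.trans_le (hcm.le_mass x y)

theorem continuous_left {ψ : Y → ℝ} (hψ : Continuous ψ) :
    Continuous (Function.uncurry fun x y => c x y - ψ y * m x y) :=
  hcm.continuous_cost.sub ((hψ.comp continuous_snd).mul hcm.continuous_mass)

theorem continuous_right {φ : X → ℝ} (hφ : Continuous φ) :
    Continuous (Function.uncurry fun y x => (c x y - φ x) / m x y) :=
  ((hcm.continuous_cost.comp continuous_swap).sub (hφ.comp continuous_snd)).div
    (hcm.continuous_mass.comp continuous_swap) fun p => (hcm.mass_pos p.2 p.1).ne'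

theorem continuous_left_apply {ψ : Y → ℝ} (hψ : Continuous ψ) (x : X) :
    Continuous fun y => c x y - ψ y * m x y :=
  (hcm.continuous_left hψ).comp (Continuous.prodMk_right x)

theorem continuous_right_apply {φ : X → ℝ} (hφ : Continuous φ) (y : Y) :
    Continuous fun x => (c x y - φ x) / m x y :=
  (hcm.continuous_right hφ).comp (Continuous.prodMk_right y)

section Left

variable [CompactSpace Y] [Nonempty Y] {φ : X → ℝ} {ψ : Y → ℝ}

theorem continuous_leftTransform (hψ : Continuous ψ) : Continuous (leftTransform c m ψ) :=
  continuous_infOver (hcm.continuous_left hψ)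

theorem leftTransform_le (hψ : Continuous ψ) (x : X) (y : Y) :
    leftTransform c m ψ x ≤ c x y - ψ y * m x y :=
  infOver_le (A := fun x y => c x y - ψ y * m x y) (hcm.continuous_left_apply hψ x) y

theorem exists_leftTransform_eq (hψ : Continuous ψ) (x : X) :
    ∃ y, c x y - ψ y * m x y = leftTransform c m ψ x :=
  let ⟨y, hy, _⟩ := exists_infOver_eq (A := fun x y => c x y - ψ y * m x y)
    (hcm.continuous_left_apply hψ x)
  ⟨y, hy⟩

theorem isFeasible_leftTransform (hψ : Continuous ψ) :
    IsFeasible c m (leftTransform c m ψ) ψ := fun x y => by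
  linarith [hcm.leftTransform_le hψ x y]

theorem le_leftTransform (hψ : Continuous ψ) (h : IsFeasible c m φ ψ) (x : X) :
    φ x ≤ leftTransform c m ψ x := by
  obtain ⟨y, hy⟩ := hcm.exists_leftTransform_eq hψ x
  linarith [h x y]

theorem abs_leftTransform_sub_le (hψ : Continuous ψ) {C : ℝ} (hC : ∀ y, |ψ y| ≤ C) (x x' : X) :
    |leftTransform c m ψ x - leftTransform c m ψ x'| ≤ (L + C * L) * dist x x' := by
  refine abs_infOver_sub_le (A := fun x y => c x y - ψ y * m x y)
    (hcm.continuous_left_apply hψ x) (hcm.continuous_left_apply hψ x') fun y => ?_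
  have h₁ : |ψ y * (m x y - m x' y)| ≤ C * (L * dist x x') := by
    rw [abs_mul]
    exact mul_le_mul (hC y) (hcm.mass_left x x' y) (abs_nonneg _) ((abs_nonneg _).trans (hC y))
  calc |c x y - ψ y * m x y - (c x' y - ψ y * m x' y)|
      = |(c x y - c x' y) - ψ y * (m x y - m x' y)| := by ring_nf
    _ ≤ |c x y - c x' y| + |ψ y * (m x y - m x' y)| := abs_sub _ _
    _ ≤ L * dist x x' + C * (L * dist x x') := add_le_add (hcm.cost_left x x' y) h₁
    _ = _ := by ring

end Left

section Right

variable [CompactSpace X] [Nonempty X] {φ : X → ℝ} {ψ : Y → ℝ}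

theorem continuous_rightTransform (hφ : Continuous φ) : Continuous (rightTransform c m φ) :=
  continuous_infOver (hcm.continuous_right hφ)

theorem rightTransform_le (hφ : Continuous φ) (x : X) (y : Y) :
    rightTransform c m φ y ≤ (c x y - φ x) / m x y :=
  infOver_le (A := fun y x => (c x y - φ x) / m x y) (hcm.continuous_right_apply hφ y) x

theorem exists_rightTransform_eq (hφ : Continuous φ) (y : Y) :
    ∃ x, (c x y - φ x) / m x y = rightTransform c m φ y :=
  let ⟨x, hx, _⟩ := exists_infOver_eq (A := fun y x => (c x y - φ x) / m x y)
    (hcm.continuous_right_apply hφ y)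
  ⟨x, hx⟩

theorem isFeasible_rightTransform (hφ : Continuous φ) :
    IsFeasible c m φ (rightTransform c m φ) := fun x y => by
  have := hcm.rightTransform_le hφ x y
  rw [le_div_iff₀ (hcm.mass_pos x y)] at this
  linarith

theorem le_rightTransform (hφ : Continuous φ) (h : IsFeasible c m φ ψ) (y : Y) :
    ψ y ≤ rightTransform c m φ y := by
  obtain ⟨x, hx⟩ := hcm.exists_rightTransform_eq hφ y
  rw [← hx, le_div_iff₀ (hcm.mass_pos x y)]
  linarith [h x y]

theorem abs_rightTransform_sub_le (hφ : Continuous φ) {C : ℝ} (hC : ∀ x y, |c x y - φ x| ≤ C)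
    (y y' : Y) :
    |rightTransform c m φ y - rightTransform c m φ y'| ≤ (C + b) * L / a ^ 2 * dist y y' := by
  refine abs_infOver_sub_le (A := fun y x => (c x y - φ x) / m x y)
    (hcm.continuous_right_apply hφ y) (hcm.continuous_right_apply hφ y') fun x => ?_
  have hm := hcm.mass_pos x y
  have hm' := hcm.mass_pos x y'
  have h₁ : |(c x y - φ x) * (m x y' - m x y)| ≤ C * (L * dist y y') := by
    rw [abs_mul, abs_sub_comm (m x y')]
    exact mul_le_mul (hC x y) (hcm.mass_right x y y') (abs_nonneg _)
      ((abs_nonneg _).trans (hC x y))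
  have h₂ : |m x y * (c x y - c x y')| ≤ b * (L * dist y y') := by
    rw [abs_mul, abs_of_pos hm]
    exact mul_le_mul (hcm.mass_le x y) (hcm.cost_right x y y') (abs_nonneg _)
      (hm.le.trans (hcm.mass_le x y))
  have h₃ : a ^ 2 ≤ m x y * m x y' := by
    rw [sq]
    exact mul_le_mul (hcm.le_mass x y) (hcm.le_mass x y') hcm.pos.le hm.le
  have h₄ : (c x y - φ x) / m x y - (c x y' - φ x) / m x y' =
      ((c x y - φ x) * (m x y' - m x y) + m x y * (c x y - c x y')) / (m x y * m x y') := by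
    field_simp
    ring
  have h₅ : |(c x y - φ x) * (m x y' - m x y) + m x y * (c x y - c x y')| ≤
      (C + b) * L * dist y y' := by
    refine (abs_add_le _ _).trans ?_
    linarith
  rw [h₄, abs_div, abs_of_pos (mul_pos hm hm'), div_mul_eq_mul_div]
  exact div_le_div₀ ((abs_nonneg _).trans h₅) h₅ (pow_pos hcm.pos 2) h₃

end Right

variable [CompactSpace X] [Nonempty X] [CompactSpace Y] [Nonempty Y]

/-- A feasible pair with `ψ ≥ 0` somewhere and `φ ≥ c₀` somewhere is dominated by a pair of
conjugate potentials with uniform bounds. -/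
theorem exists_conjugate_pair {φ : X → ℝ} {ψ : Y → ℝ} (hψ : Continuous ψ)
    (h : IsFeasible c m φ ψ) {x₁ : X} (hx₁ : c₀ ≤ φ x₁) {y₀ : Y} (hy₀ : 0 ≤ ψ y₀) :
    ∃ φ' ψ', Continuous φ' ∧ Continuous ψ' ∧ IsFeasible c m φ' ψ' ∧
      (∀ x, φ x ≤ φ' x) ∧ (∀ y, ψ y ≤ ψ' y) ∧
      (∀ x, |φ' x| ≤ |c₀| + |c₁| + (c₁ - c₀) / a * b) ∧ (∀ y, |ψ' y| ≤ (c₁ - c₀) / a) ∧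
      (∀ x x', |φ' x - φ' x'| ≤ (L + (c₁ - c₀) / a * L) * dist x x') ∧
      (∀ y y', |ψ' y - ψ' y'| ≤
        (2 * (|c₀| + |c₁|) + (c₁ - c₀) / a * b + b) * L / a ^ 2 * dist y y') ∧
      (∀ x, ∃ y, φ' x + ψ' y * m x y = c x y) ∧ ∀ y, ∃ x, φ' x + ψ' y * m x y = c x y := by
  have ha := hcm.pos
  set C := (c₁ - c₀) / a with hCdef
  have h01 : c₀ ≤ c₁ := (hcm.le_cost x₁ y₀).trans (hcm.cost_le x₁ y₀)
  have hC0 : 0 ≤ C := div_nonneg (sub_nonneg.2 h01) ha.le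
  have hCa : C * a = c₁ - c₀ := div_mul_cancel₀ _ ha.ne'
  -- Four transforms are taken. The first gives `φ₂ ≤ c₁` (test at `y₀`), the second two-sided
  -- bounds on `ψ₃`. Only then do the last two have uniform Lipschitz constants, as transforms of
  -- uniformly bounded functions.
  set φ₂ := leftTransform c m ψ with hφ₂def
  have hφ₂ : Continuous φ₂ := hcm.continuous_leftTransform hψ
  have hφφ₂ : ∀ x, φ x ≤ φ₂ x := hcm.le_leftTransform hψ h
  have hφ₂le : ∀ x, φ₂ x ≤ c₁ := fun x => by
    have := hcm.leftTransform_le hψ x y₀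
    have h₁ := mul_nonneg hy₀ (hcm.mass_pos x y₀).le
    linarith [hcm.cost_le x y₀]
  have upper : ∀ {φ₀ : X → ℝ}, Continuous φ₀ → c₀ ≤ φ₀ x₁ →
      ∀ y, rightTransform c m φ₀ y ≤ C := fun {φ₀} hc h₀ y => by
    refine (hcm.rightTransform_le hc x₁ y).trans ?_
    rw [div_le_iff₀ (hcm.mass_pos x₁ y)]
    nlinarith [hcm.cost_le x₁ y, hcm.le_mass x₁ y]
  set ψ₃ := rightTransform c m φ₂ with hψ₃def
  have hψ₃ : Continuous ψ₃ := hcm.continuous_rightTransform hφ₂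
  have hψψ₃ : ∀ y, ψ y ≤ ψ₃ y :=
    hcm.le_rightTransform hφ₂ (hcm.isFeasible_leftTransform hψ)
  have hψ₃up : ∀ y, ψ₃ y ≤ C := upper hφ₂ (hx₁.trans (hφφ₂ x₁))
  have hψ₃low : ∀ y, -C ≤ ψ₃ y := fun y => by
    obtain ⟨x, hx⟩ := hcm.exists_rightTransform_eq hφ₂ y
    rw [hψ₃def, ← hx, le_div_iff₀ (hcm.mass_pos x y)]
    nlinarith [hcm.le_cost x y, hcm.le_mass x y, hφ₂le x]
  have hψ₃abs : ∀ y, |ψ₃ y| ≤ C := fun y => abs_le.2 ⟨hψ₃low y, hψ₃up y⟩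
  set φ₄ := leftTransform c m ψ₃ with hφ₄def
  have hφ₄ : Continuous φ₄ := hcm.continuous_leftTransform hψ₃
  have hφ₂φ₄ : ∀ x, φ₂ x ≤ φ₄ x :=
    hcm.le_leftTransform hψ₃ (hcm.isFeasible_rightTransform hφ₂)
  have hφ₄abs : ∀ x, |φ₄ x| ≤ |c₀| + |c₁| + C * b := fun x => by
    obtain ⟨y, hy⟩ := hcm.exists_leftTransform_eq hψ₃ x
    have h₁ : |ψ₃ y * m x y| ≤ C * b := by
      rw [abs_mul, abs_of_pos (hcm.mass_pos x y)]
      exact mul_le_mul (hψ₃abs y) (hcm.mass_le x y) (hcm.mass_pos x y).le hC0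
    rw [abs_le] at h₁ ⊢
    rw [hφ₄def, ← hy]
    constructor <;> linarith [hcm.le_cost x y, hcm.cost_le x y, le_abs_self c₁, neg_abs_le c₀,
      abs_nonneg c₀, abs_nonneg c₁]
  set ψ₅ := rightTransform c m φ₄ with hψ₅def
  have hψ₅ : Continuous ψ₅ := hcm.continuous_rightTransform hφ₄
  have hfeas : IsFeasible c m φ₄ ψ₅ := hcm.isFeasible_rightTransform hφ₄
  have hψ₃ψ₅ : ∀ y, ψ₃ y ≤ ψ₅ y :=
    hcm.le_rightTransform hφ₄ (hcm.isFeasible_leftTransform hψ₃)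
  have hcost : ∀ x y, |c x y| ≤ |c₀| + |c₁| := fun x y => abs_le.2
    ⟨by linarith [hcm.le_cost x y, neg_abs_le c₀, abs_nonneg c₁],
      by linarith [hcm.cost_le x y, le_abs_self c₁, abs_nonneg c₀]⟩
  refine ⟨φ₄, ψ₅, hφ₄, hψ₅, hfeas, fun x => (hφφ₂ x).trans (hφ₂φ₄ x),
    fun y => (hψψ₃ y).trans (hψ₃ψ₅ y), hφ₄abs, fun y => abs_le.2 ⟨(hψ₃low y).trans (hψ₃ψ₅ y),
      upper hφ₄ (hx₁.trans ((hφφ₂ x₁).trans (hφ₂φ₄ x₁))) y⟩,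
    hcm.abs_leftTransform_sub_le hψ₃ hψ₃abs, fun y y' => ?_, fun x => ?_, fun y => ?_⟩
  · refine hcm.abs_rightTransform_sub_le hφ₄ (C := 2 * (|c₀| + |c₁|) + C * b) (fun x y => ?_) y y'
    refine (abs_sub _ _).trans ?_
    linarith [hcost x y, hφ₄abs x]
  -- A contact point for `(φ₄, ψ₃)` remains one for `(φ₄, ψ₅)`, since `ψ₃ ≤ ψ₅` and the latter pair
  -- is feasible.
  · obtain ⟨y, hy⟩ := hcm.exists_leftTransform_eq hψ₃ x
    refine ⟨y, le_antisymm (hfeas x y) ?_⟩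
    have := mul_le_mul_of_nonneg_right (hψ₃ψ₅ y) (hcm.mass_pos x y).le
    linarith
  · obtain ⟨x, hx⟩ := hcm.exists_rightTransform_eq hφ₄ y
    refine ⟨x, ?_⟩
    rw [div_eq_iff (hcm.mass_pos x y).ne'] at hx
    linarith

end IsRegularCost

variable [MeasurableSpace X] [BorelSpace X] [MeasurableSpace Y] [BorelSpace Y]

/-- A solution of the dual problem: maximize `∫ φ dμ` among the continuous feasible pairs with
`∫ ψ dν ≥ 0`. -/
structure IsDualMaximizer (c m : X → Y → ℝ) (μ : Measure X) (ν : Measure Y)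
    (φ : X → ℝ) (ψ : Y → ℝ) : Prop where
  continuous_left : Continuous φ
  continuous_right : Continuous ψ
  isFeasible : IsFeasible c m φ ψ
  integral_nonneg : 0 ≤ ∫ y, ψ y ∂ν
  maximal : ∀ φ' ψ', Continuous φ' → Continuous ψ' → IsFeasible c m φ' ψ' →
    0 ≤ ∫ y, ψ' y ∂ν → ∫ x, φ' x ∂μ ≤ ∫ x, φ x ∂μ

/-- Existence of conjugate dual maximizers, with bounds independent of the measures. -/
theorem IsRegularCost.exists_isDualMaximizer [CompactSpace X] [CompactSpace Y]
    {c m : X → Y → ℝ} {c₀ c₁ a b L : ℝ} (hcm : IsRegularCost c m c₀ c₁ a b L)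
    (μ : Measure X) (ν : Measure Y) [IsProbabilityMeasure μ] [IsProbabilityMeasure ν] :
    ∃ φ ψ, IsDualMaximizer c m μ ν φ ψ ∧ (∀ y, |ψ y| ≤ (c₁ - c₀) / a) ∧
      (∃ Lφ : ℝ≥0, LipschitzWith Lφ φ) ∧ (∃ Lψ : ℝ≥0, LipschitzWith Lψ ψ) ∧
      (∀ x, ∃ y, φ x + ψ y * m x y = c x y) ∧ ∀ y, ∃ x, φ x + ψ y * m x y = c x y := by
  have hX : Nonempty X := nonempty_of_isProbabilityMeasure μ
  have hY : Nonempty Y := nonempty_of_isProbabilityMeasure ν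
  set C₁ := |c₀| + |c₁| + (c₁ - c₀) / a * b with hC₁
  set C₂ := (c₁ - c₀) / a with hC₂
  set L₁ := L + (c₁ - c₀) / a * L with hL₁
  set L₂ := (2 * (|c₀| + |c₁|) + (c₁ - c₀) / a * b + b) * L / a ^ 2 with hL₂
  set 𝒜 : Set (BoundedContinuousFunction X ℝ × BoundedContinuousFunction Y ℝ) :=
    ({f | (∀ z, f z ∈ Icc (-C₁) C₁) ∧ ∀ z z', |f z - f z'| ≤ L₁ * dist z z'} ×ˢ
      {f | (∀ z, f z ∈ Icc (-C₂) C₂) ∧ ∀ z z', |f z - f z'| ≤ L₂ * dist z z'}) ∩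
      ({p | IsFeasible c m p.1 p.2} ∩ {p | 0 ≤ ∫ y, p.2 y ∂ν}) with h𝒜
  have hcomp : IsCompact 𝒜 := by
    refine ((isCompact_lipschitz_bounded X C₁ L₁).prod
      (isCompact_lipschitz_bounded Y C₂ L₂)).inter_right (IsClosed.inter ?_ ?_)
    · simp only [IsFeasible, ofPred_forall]
      refine isClosed_iInter fun x => isClosed_iInter fun y => isClosed_le ?_ continuous_const
      have h₁ : Continuous fun f : BoundedContinuousFunction X ℝ => f x :=
        continuous_eval_const _
      have h₂ : Continuous fun f : BoundedContinuousFunction Y ℝ => f y :=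
        continuous_eval_const _
      exact (h₁.comp continuous_fst).add ((h₂.comp continuous_snd).mul continuous_const)
    · exact isClosed_le continuous_const
        ((continuous_integral_boundedContinuousFunction ν).comp continuous_snd)
  have hdom : ∀ φ' ψ', Continuous φ' → Continuous ψ' → IsFeasible c m φ' ψ' →
      0 ≤ ∫ y, ψ' y ∂ν → c₀ ≤ ∫ x, φ' x ∂μ → ∃ p ∈ 𝒜, ∫ x, φ' x ∂μ ≤ ∫ x, p.1 x ∂μ ∧
        (∀ x, ∃ y, p.1 x + p.2 y * m x y = c x y) ∧
        ∀ y, ∃ x, p.1 x + p.2 y * m x y = c x y := by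
    intro φ' ψ' hφ' hψ' hf hν hμ
    have hiφ := integrable_of_continuous μ hφ'
    have hiψ := integrable_of_continuous ν hψ'
    -- A function reaches its mean somewhere; this supplies the points at which `φ' ≥ c₀` and `ψ' ≥
    -- 0`.
    obtain ⟨x₁, hx₁⟩ := exists_integral_le hiφ
    obtain ⟨y₀, hy₀⟩ := exists_integral_le hiψ
    obtain ⟨f, g, hfc, hgc, hfg, hφf, hψg, hfb, hgb, hfl, hgl, hct₁, hct₂⟩ :=
      hcm.exists_conjugate_pair hψ' hf (hμ.trans hx₁) (hν.trans hy₀)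
    refine ⟨(BoundedContinuousFunction.mkOfCompact ⟨f, hfc⟩,
      BoundedContinuousFunction.mkOfCompact ⟨g, hgc⟩),
      ⟨⟨⟨fun x => abs_le.1 (hfb x), hfl⟩, ⟨fun y => abs_le.1 (hgb y), hgl⟩⟩, hfg, ?_⟩, ?_,
      hct₁, hct₂⟩
    · exact hν.trans (integral_mono hiψ (integrable_of_continuous ν hgc) hψg)
    · exact integral_mono hiφ (integrable_of_continuous μ hfc) hφf
  -- The constant pair `(c₀, 0)` shows that `𝒜` is nonempty and that pairs of value below `c₀`
  -- cannot compete.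
  obtain ⟨p₀, hp₀, hp₀'⟩ := hdom (fun _ => c₀) (fun _ => 0) continuous_const continuous_const
    (fun x y => by simpa using hcm.le_cost x y) (by simp) (by simp)
  obtain ⟨q, hq, hqmax⟩ := hcomp.exists_isMaxOn ⟨p₀, hp₀⟩
    ((continuous_integral_boundedContinuousFunction μ).comp continuous_fst).continuousOn
  have hqc : c₀ ≤ ∫ x, q.1 x ∂μ := by
    have := hqmax hp₀
    simp only [mem_ofPred_eq, Function.comp] at this
    exact le_trans (by simpa using hp₀'.1) this
  -- A maximizer over `𝒜` need not be conjugate; one more improvement supplies the contact points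
  -- without lowering the value.
  obtain ⟨p, hp, hqp, hct₁, hct₂⟩ := hdom q.1 q.2 q.1.continuous q.2.continuous hq.2.1 hq.2.2 hqc
  refine ⟨p.1, p.2, ⟨p.1.continuous, p.2.continuous, hp.2.1, hp.2.2, ?_⟩,
    fun y => abs_le.2 (hp.1.2.1 y), ⟨L₁.toNNReal, ?_⟩, ⟨L₂.toNNReal, ?_⟩, hct₁, hct₂⟩
  · intro φ' ψ' hφ' hψ' hf hν
    by_contra! hlt
    obtain ⟨r, hr, hφr, -⟩ := hdom φ' ψ' hφ' hψ' hf hν (hqc.trans (hqp.trans hlt.le))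
    have := hqmax hr
    simp only [mem_ofPred_eq, Function.comp] at this
    linarith
  · refine LipschitzWith.of_dist_le' fun x x' => ?_
    exact hp.1.1.2 x x'
  · refine LipschitzWith.of_dist_le' fun x x' => ?_
    exact hp.1.2.2 x x'

/-- Slack `t` in `∫ ψ' dν ≥ 0` can be traded for value: since `m ≥ a`, lowering `ψ'` by `t` leaves
room to raise `φ'` by `a t`. -/
theorem IsDualMaximizer.integral_add_le [CompactSpace X] [CompactSpace Y]
    {c m : X → Y → ℝ} {c₀ c₁ a b L : ℝ} (hcm : IsRegularCost c m c₀ c₁ a b L)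
    {μ : Measure X} {ν : Measure Y} [IsProbabilityMeasure μ] [IsProbabilityMeasure ν]
    {φ : X → ℝ} {ψ : Y → ℝ} (h : IsDualMaximizer c m μ ν φ ψ) {φ' : X → ℝ} {ψ' : Y → ℝ}
    (hφ' : Continuous φ') (hψ' : Continuous ψ') (hf : IsFeasible c m φ' ψ')
    (hν : 0 ≤ ∫ y, ψ' y ∂ν) : ∫ x, φ' x ∂μ + a * ∫ y, ψ' y ∂ν ≤ ∫ x, φ x ∂μ := by
  set t := ∫ y, ψ' y ∂ν with ht
  have := h.maximal (fun x => φ' x + a * t) (fun y => ψ' y - t) (by fun_prop) (by fun_prop)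
    (fun x y => ?_) ?_
  · rwa [integral_add (integrable_of_continuous μ hφ') (integrable_const _), integral_const,
      probReal_univ, one_smul] at this
  · have h₁ := hf x y
    have h₂ := mul_le_mul_of_nonneg_right (hcm.le_mass x y) hν
    nlinarith
  · rw [integral_sub (integrable_of_continuous ν hψ') (integrable_const _)]
    simp [ht]

theorem IsDualMaximizer.integral_eq_zero [CompactSpace X] [CompactSpace Y]
    {c m : X → Y → ℝ} {c₀ c₁ a b L : ℝ} (hcm : IsRegularCost c m c₀ c₁ a b L)
    {μ : Measure X} {ν : Measure Y} [IsProbabilityMeasure μ] [IsProbabilityMeasure ν]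
    {φ : X → ℝ} {ψ : Y → ℝ} (h : IsDualMaximizer c m μ ν φ ψ) : ∫ y, ψ y ∂ν = 0 := by
  have := h.integral_add_le hcm h.continuous_left h.continuous_right h.isFeasible
    h.integral_nonneg
  refine le_antisymm ?_ h.integral_nonneg
  by_contra! hpos
  nlinarith [mul_pos hcm.pos hpos]

end DualProblem
theorem withDensity_map_eq {α β : Type*} [MeasurableSpace α] [MeasurableSpace β]
    (κ : Measure α) {g : α → β} (hg : Measurable g) {f : β → ℝ≥0∞} (hf : Measurable f) :
    (κ.map g).withDensity f = (κ.withDensity fun a => f (g a)).map g := by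
  ext s hs
  rw [withDensity_apply _ hs, Measure.map_apply hg hs, withDensity_apply _ (hg hs),
    setLIntegral_map hs hf hg]

/-! ### From contact sets to optimal plans and maps -/

section PlanLemmas

variable {X Y : Type*} [MetricSpace X] [CompactSpace X] [MeasurableSpace X] [BorelSpace X]
  [MetricSpace Y] [CompactSpace Y] [MeasurableSpace Y] [BorelSpace Y]
  {c m : X → Y → ℝ} {c₀ c₁ a b L : ℝ} {μ : Measure X} {ν : Measure Y}
  {φ : X → ℝ} {ψ : Y → ℝ} {π : Measure (X × Y)}

theorem IsRegularCost.measurable_mass (hcm : IsRegularCost c m c₀ c₁ a b L) :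
    Measurable fun p : X × Y => ENNReal.ofReal (m p.1 p.2) :=
  ENNReal.measurable_ofReal.comp hcm.continuous_mass.measurable

theorem IsPlan.map_fst (h : IsPlan m μ ν π) : π.map Prod.fst = μ := by
  ext A hA
  rw [Measure.map_apply measurable_fst hA, ← h.first_marginal A hA, prod_univ]

theorem IsRegularCost.lintegral_mass_ne_zero (hcm : IsRegularCost c m c₀ c₁ a b L)
    [IsProbabilityMeasure π] : ∫⁻ p, ENNReal.ofReal (m p.1 p.2) ∂π ≠ 0 := by
  have h : ∫⁻ _, ENNReal.ofReal a ∂π ≤ ∫⁻ p, ENNReal.ofReal (m p.1 p.2) ∂π :=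
    lintegral_mono fun p => ENNReal.ofReal_le_ofReal (hcm.le_mass p.1 p.2)
  simp only [lintegral_const, measure_univ, mul_one] at h
  exact ((ENNReal.ofReal_pos.2 hcm.pos).trans_le h).ne'

theorem IsRegularCost.lintegral_mass_ne_top (hcm : IsRegularCost c m c₀ c₁ a b L)
    [IsProbabilityMeasure π] : ∫⁻ p, ENNReal.ofReal (m p.1 p.2) ∂π ≠ ⊤ := by
  have h : ∫⁻ p, ENNReal.ofReal (m p.1 p.2) ∂π ≤ ∫⁻ _, ENNReal.ofReal b ∂π :=
    lintegral_mono fun p => ENNReal.ofReal_le_ofReal (hcm.mass_le p.1 p.2)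
  simp only [lintegral_const, measure_univ, mul_one] at h
  exact (h.trans_lt ENNReal.ofReal_lt_top).ne

theorem IsPlan.map_snd_withDensity (hcm : IsRegularCost c m c₀ c₁ a b L) (h : IsPlan m μ ν π) :
    (π.withDensity fun p => ENNReal.ofReal (m p.1 p.2)).map Prod.snd =
      (∫⁻ p, ENNReal.ofReal (m p.1 p.2) ∂π) • ν := by
  have := h.isProbabilityMeasure
  ext B hB
  have hB' := (h.second_marginal B hB).symm
  rw [ENNReal.eq_div_iff hcm.lintegral_mass_ne_zero hcm.lintegral_mass_ne_top] at hB'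
  rw [Measure.map_apply measurable_snd hB, withDensity_apply _ (measurable_snd hB),
    ← univ_prod, ← hB', Measure.smul_apply, smul_eq_mul]

/-- The factor `r` may be arbitrary, because comparing total masses forces it to be the normalizing
constant. -/
theorem IsPlan.of_map (hcm : IsRegularCost c m c₀ c₁ a b L) [IsProbabilityMeasure ν]
    [IsProbabilityMeasure π] (h₁ : π.map Prod.fst = μ) {r : ℝ≥0∞}
    (h₂ : (π.withDensity fun p => ENNReal.ofReal (m p.1 p.2)).map Prod.snd = r • ν) :
    IsPlan m μ ν π := by
  have hr : ∫⁻ p, ENNReal.ofReal (m p.1 p.2) ∂π = r := by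
    have := congrArg (fun κ => κ univ) h₂
    simpa [Measure.map_apply measurable_snd MeasurableSet.univ] using this
  refine ⟨inferInstance, fun A hA => ?_, fun B hB => ?_⟩
  · rw [← h₁, Measure.map_apply measurable_fst hA, prod_univ]
  · have hB' := congrArg (fun κ => κ B) h₂
    simp only [Measure.smul_apply, smul_eq_mul] at hB'
    rw [Measure.map_apply measurable_snd hB, withDensity_apply _ (measurable_snd hB),
      ← univ_prod, ← hr] at hB'
    symm
    rw [ENNReal.eq_div_iff hcm.lintegral_mass_ne_zero hcm.lintegral_mass_ne_top]
    exact hB'.symm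

/-- The second marginal of `m π` is a multiple of `ν`, so the `ψ` term integrates to zero. The value
is thus the same for all plans. -/
theorem IsPlan.integral_potentials (hcm : IsRegularCost c m c₀ c₁ a b L)
    (h : IsPlan m μ ν π) (hφ : Continuous φ) (hψ : Continuous ψ) (hν : ∫ y, ψ y ∂ν = 0) :
    ∫ p, (φ p.1 + ψ p.2 * m p.1 p.2) ∂π = ∫ x, φ x ∂μ := by
  have := h.isProbabilityMeasure
  have hm : Continuous fun p : X × Y => m p.1 p.2 := hcm.continuous_mass
  have h₁ : ∫ p, φ p.1 ∂π = ∫ x, φ x ∂μ := by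
    rw [← h.map_fst, integral_map measurable_fst.aemeasurable hφ.aestronglyMeasurable]
  have h₂ : ∫ p, ψ p.2 * m p.1 p.2 ∂π = 0 := by
    have h₃ := integral_map (μ := π.withDensity fun p => ENNReal.ofReal (m p.1 p.2))
      measurable_snd.aemeasurable (f := ψ) hψ.aestronglyMeasurable
    rw [h.map_snd_withDensity hcm, integral_smul_measure, hν, smul_zero,
      integral_withDensity_eq_integral_toReal_smul hcm.measurable_mass (by simp)] at h₃
    rw [h₃]
    refine integral_congr_ae (ae_of_all _ fun p => ?_)
    simp only [smul_eq_mul]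
    rw [ENNReal.toReal_ofReal (hcm.mass_pos _ _).le, mul_comm]
  rw [integral_add (integrable_of_continuous π (by fun_prop))
    (integrable_of_continuous π (by fun_prop)), h₁, h₂, add_zero]

/-- Weak duality: a feasible pair bounds the cost of every plan below by `∫ φ dμ`, and a plan on the
contact set attains this bound. -/
theorem IsPlan.isOptimalPlan (hcm : IsRegularCost c m c₀ c₁ a b L) (h : IsPlan m μ ν π)
    (hφ : Continuous φ) (hψ : Continuous ψ) (hf : IsFeasible c m φ ψ) (hν : ∫ y, ψ y ∂ν = 0)
    (hae : ∀ᵐ p ∂π, φ p.1 + ψ p.2 * m p.1 p.2 = c p.1 p.2) : IsOptimalPlan c m μ ν π := by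
  have := h.isProbabilityMeasure
  have hm : Continuous fun p : X × Y => m p.1 p.2 := hcm.continuous_mass
  refine ⟨h, integrable_of_continuous π hcm.continuous_cost, fun π' h' hi => ?_⟩
  have := h'.isProbabilityMeasure
  rw [← integral_congr_ae hae, h.integral_potentials hcm hφ hψ hν,
    ← h'.integral_potentials hcm hφ hψ hν]
  exact integral_mono (integrable_of_continuous π' (by fun_prop)) hi fun p => hf p.1 p.2

/-- Every optimal plan is concentrated on the contact set as soon as one plan is. -/
theorem IsOptimalPlan.ae_contact (hcm : IsRegularCost c m c₀ c₁ a b L)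
    {π₀ : Measure (X × Y)} (h₀ : IsPlan m μ ν π₀) (hφ : Continuous φ) (hψ : Continuous ψ)
    (hf : IsFeasible c m φ ψ) (hν : ∫ y, ψ y ∂ν = 0)
    (hae : ∀ᵐ p ∂π₀, φ p.1 + ψ p.2 * m p.1 p.2 = c p.1 p.2) (h : IsOptimalPlan c m μ ν π) :
    ∀ᵐ p ∂π, φ p.1 + ψ p.2 * m p.1 p.2 = c p.1 p.2 := by
  have := h.isPlan.isProbabilityMeasure
  have := h₀.isProbabilityMeasure
  have hm : Continuous fun p : X × Y => m p.1 p.2 := hcm.continuous_mass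
  have hle := h.minimal π₀ h₀ (integrable_of_continuous π₀ hcm.continuous_cost)
  rw [← integral_congr_ae hae, h₀.integral_potentials hcm hφ hψ hν,
    ← h.isPlan.integral_potentials hcm hφ hψ hν] at hle
  have hi : Integrable (fun p : X × Y => φ p.1 + ψ p.2 * m p.1 p.2) π :=
    integrable_of_continuous π (by fun_prop)
  have hz := (integral_eq_zero_iff_of_nonneg
    (f := fun p : X × Y => c p.1 p.2 - (φ p.1 + ψ p.2 * m p.1 p.2))
    (fun p => sub_nonneg.2 (hf p.1 p.2)) (h.integrable.sub hi)).1 (by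
      refine le_antisymm ?_ (integral_nonneg fun p => sub_nonneg.2 (hf p.1 p.2))
      rw [integral_sub h.integrable hi]
      linarith)
  filter_upwards [hz] with p hp
  simp only [Pi.zero_apply] at hp
  linarith

theorem isClosed_contact (hcm : IsRegularCost c m c₀ c₁ a b L) (hφ : Continuous φ)
    (hψ : Continuous ψ) :
    IsClosed {p : X × Y | φ p.1 + ψ p.2 * m p.1 p.2 = c p.1 p.2} := by
  have hm : Continuous fun p : X × Y => m p.1 p.2 := hcm.continuous_mass
  exact isClosed_eq (by fun_prop) hcm.continuous_cost

/-- If almost every `x` has a single contact point, the optimal plan exists, is unique and is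
induced by a map. -/
theorem IsDualMaximizer.exists_optimal_map (hcm : IsRegularCost c m c₀ c₁ a b L)
    [IsProbabilityMeasure μ] [IsProbabilityMeasure ν] (h : IsDualMaximizer c m μ ν φ ψ)
    (hex : ∀ x, ∃ y, φ x + ψ y * m x y = c x y)
    (huniq : ∀ᵐ x ∂μ, ∀ y y', φ x + ψ y * m x y = c x y → φ x + ψ y' * m x y' = c x y' → y = y') :
    (∃ π, IsOptimalPlan c m μ ν π) ∧ ∃ T : X → Y, ∀ π, IsOptimalPlan c m μ ν π →
      IsInducedByMap μ π T ∧ ∀ T' : X → Y, IsInducedByMap μ π T' → T' =ᵐ[μ] T := by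
  have hY : Nonempty Y := nonempty_of_isProbabilityMeasure ν
  have hφ := h.continuous_left
  have hψ := h.continuous_right
  have hψ0 : ∫ y, ψ y ∂ν = 0 := h.integral_eq_zero hcm
  have hmc : Continuous fun p : X × Y => m p.1 p.2 := hcm.continuous_mass
  obtain ⟨T, hT, hTF, hTu⟩ := exists_measurable_selection μ (isClosed_contact hcm hφ hψ) hex huniq
  have hφeq : ∀ x, infOver (fun x y => c x y - ψ y * m x y) x = φ x := fun x => by
    obtain ⟨y, hy⟩ := hex x
    refine le_antisymm ?_ (hcm.le_leftTransform hψ h.isFeasible x)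
    exact (hcm.leftTransform_le hψ x y).trans_eq (by linarith)
  have hmT : Measurable fun x => ENNReal.ofReal (m x (T x)) :=
    hcm.measurable_mass.comp (measurable_id.prodMk hT)
  set ρ := (μ.withDensity fun x => ENNReal.ofReal (m x (T x))).map T with hρ
  have hρfin : IsFiniteMeasure (μ.withDensity fun x => ENNReal.ofReal (m x (T x))) := by
    refine isFiniteMeasure_withDensity (ne_top_of_le_ne_top (b := ENNReal.ofReal b) (by simp) ?_)
    refine (lintegral_mono fun x => ENNReal.ofReal_le_ofReal (hcm.mass_le x (T x))).trans ?_
    simp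
  -- First variation along `ψ + s η` with `∫ η dν = 0`: the constraint is preserved, and the left
  -- transform supplies the competitor in the first slot.
  have hρν : ρ = ρ univ • ν := by
    refine eq_smul_of_integral_nonneg ν ρ fun η hη hη0 => ?_
    rw [hρ, integral_map hT.aemeasurable hη.aestronglyMeasurable,
      integral_withDensity_eq_integral_toReal_smul hmT (by simp)]
    have hD := integral_nonneg_of_integral_infOver_le μ (hcm.continuous_left hψ)
      (B := fun x y => η y * m x y) ((hη.comp continuous_snd).mul hmc) (T := T) ?_ fun s hs => ?_
    · refine hD.trans_eq (integral_congr_ae (ae_of_all _ fun x => ?_))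
      simp only [smul_eq_mul]
      rw [ENNReal.toReal_ofReal (hcm.mass_pos _ _).le, mul_comm]
    · filter_upwards [hTu] with x hx y hy
      rw [hφeq] at hy
      exact hx y (show φ x + ψ y * m x y = c x y by linarith)
    · simp only [hφeq]
      have hsη : Continuous fun y => ψ y + s * η y := by fun_prop
      have hfun : infOver (fun x y => c x y - ψ y * m x y - s * (η y * m x y)) =
          leftTransform c m fun y => ψ y + s * η y := by
        unfold leftTransform
        congr 1
        ext x y
        ring
      rw [hfun]
      refine h.maximal _ _ (hcm.continuous_leftTransform hsη) hsη
        (hcm.isFeasible_leftTransform hsη) ?_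
      rw [integral_add (integrable_of_continuous ν hψ)
        (integrable_of_continuous ν (by fun_prop)), integral_const_mul, hψ0, hη0]
      simp
  have hgraph : Measurable fun x => (x, T x) := measurable_id.prodMk hT
  set π₀ := μ.map fun x => (x, T x) with hπ₀
  have hπ₀prob : IsProbabilityMeasure π₀ := Measure.isProbabilityMeasure_map hgraph.aemeasurable
  have hplan : IsPlan m μ ν π₀ := by
    refine IsPlan.of_map hcm (r := ρ univ) ?_ ?_
    · rw [hπ₀, Measure.map_map measurable_fst hgraph]
      exact Measure.map_id
    · rw [hπ₀, withDensity_map_eq _ hgraph hcm.measurable_mass,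
        Measure.map_map measurable_snd hgraph]
      exact hρν
  have hae : ∀ᵐ p ∂π₀, φ p.1 + ψ p.2 * m p.1 p.2 = c p.1 p.2 := by
    rw [hπ₀, ae_map_iff hgraph.aemeasurable (isClosed_contact hcm hφ hψ).measurableSet]
    exact hTF
  refine ⟨⟨π₀, hplan.isOptimalPlan hcm hφ hψ h.isFeasible hψ0 hae⟩, T, fun π hπ => ?_⟩
  have hcon := hπ.ae_contact hcm hplan hφ hψ h.isFeasible hψ0 hae
  have hTπ : ∀ᵐ p ∂π, ∀ z, φ p.1 + ψ z * m p.1 z = c p.1 z → z = T p.1 := by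
    have := hπ.isPlan.map_fst ▸ hTu
    exact ae_of_ae_map measurable_fst.aemeasurable this
  have hind : π = μ.map fun x => (x, T x) :=
    eq_map_of_ae_eq hπ.isPlan.map_fst hT (by filter_upwards [hcon, hTπ] with p h₁ h₂ using h₂ _ h₁)
  exact ⟨⟨hT, hind⟩, fun T' hT' => ae_eq_of_map_eq hT hT'.1 (hind.symm.trans hT'.2)⟩

theorem IsRegularCost.measurable_inv_mass (hcm : IsRegularCost c m c₀ c₁ a b L) {S : Y → X}
    (hS : Measurable S) : Measurable fun y => ENNReal.ofReal (1 / m (S y) y) := by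
  have : Measurable fun y => m (S y) y :=
    hcm.continuous_mass.measurable.comp (hS.prodMk measurable_id)
  exact ENNReal.measurable_ofReal.comp (measurable_const.div this)

theorem IsRegularCost.ofReal_inv_mass (hcm : IsRegularCost c m c₀ c₁ a b L) (x : X) (y : Y) :
    ENNReal.ofReal (1 / m x y) = (ENNReal.ofReal (m x y))⁻¹ := by
  rw [one_div, ENNReal.ofReal_inv_of_pos (hcm.mass_pos x y)]

theorem IsRegularCost.lintegral_inv_mass_ne_top (hcm : IsRegularCost c m c₀ c₁ a b L)
    [IsProbabilityMeasure ν] (S : Y → X) : ∫⁻ y, ENNReal.ofReal (1 / m (S y) y) ∂ν ≠ ⊤ := by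
  refine ne_top_of_le_ne_top (b := ENNReal.ofReal (1 / a)) (by simp) ?_
  refine (lintegral_mono fun y => ENNReal.ofReal_le_ofReal
    (one_div_le_one_div_of_le hcm.pos (hcm.le_mass (S y) y))).trans ?_
  simp

theorem IsRegularCost.lintegral_inv_mass_ne_zero (hcm : IsRegularCost c m c₀ c₁ a b L)
    [IsProbabilityMeasure ν] (S : Y → X) : ∫⁻ y, ENNReal.ofReal (1 / m (S y) y) ∂ν ≠ 0 := by
  obtain ⟨y⟩ := nonempty_of_isProbabilityMeasure ν
  have hb : 0 < b := (hcm.mass_pos (S y) y).trans_le (hcm.mass_le _ _)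
  have h : ∫⁻ _, ENNReal.ofReal (1 / b) ∂ν ≤ ∫⁻ y, ENNReal.ofReal (1 / m (S y) y) ∂ν :=
    lintegral_mono fun y => ENNReal.ofReal_le_ofReal
      (one_div_le_one_div_of_le (hcm.mass_pos _ _) (hcm.mass_le (S y) y))
  simp only [lintegral_const, measure_univ, mul_one] at h
  exact ((ENNReal.ofReal_pos.2 (one_div_pos.2 hb)).trans_le h).ne'

theorem IsRegularCost.absolutelyContinuous_dualSource (hcm : IsRegularCost c m c₀ c₁ a b L)
    [IsProbabilityMeasure ν] {S : Y → X} (hS : Measurable S) : ν ≪ dualSource m ν S := by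
  refine (withDensity_absolutelyContinuous' (hcm.measurable_inv_mass hS).aemeasurable
    (ae_of_all _ fun y => ?_)).trans (Measure.absolutelyContinuous_smul ?_)
  · exact (ENNReal.ofReal_pos.2 (one_div_pos.2 (hcm.mass_pos _ _))).ne'
  · exact ENNReal.inv_ne_zero.2 (hcm.lintegral_inv_mass_ne_top S)

theorem IsRegularCost.dualSource_univ (hcm : IsRegularCost c m c₀ c₁ a b L)
    [IsProbabilityMeasure ν] (S : Y → X) : dualSource m ν S univ = 1 := by
  rw [dualSource, Measure.smul_apply, withDensity_apply _ MeasurableSet.univ,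
    Measure.restrict_univ, smul_eq_mul]
  exact ENNReal.inv_mul_cancel (hcm.lintegral_inv_mass_ne_zero S) (hcm.lintegral_inv_mass_ne_top S)

theorem IsRegularCost.withDensity_dualSource (hcm : IsRegularCost c m c₀ c₁ a b L)
    [IsProbabilityMeasure ν] {S : Y → X} (hS : Measurable S) :
    (dualSource m ν S).withDensity (fun y => ENNReal.ofReal (m (S y) y)) =
      (∫⁻ y, ENNReal.ofReal (1 / m (S y) y) ∂ν)⁻¹ • ν := by
  rw [dualSource, withDensity_smul_measure]
  congr 1
  have h := withDensity_inv_same (μ := ν) (hcm.measurable_inv_mass hS)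
    (ae_of_all _ fun y => (ENNReal.ofReal_pos.2 (one_div_pos.2 (hcm.mass_pos (S y) y))).ne')
    (ae_of_all _ fun y => ENNReal.ofReal_ne_top)
  simpa only [hcm.ofReal_inv_mass, inv_inv] using h

/-- If almost every `y` has a single contact point, the optimal plan exists, is unique and is
induced by a map from the target. -/
theorem IsDualMaximizer.exists_optimal_dual_map (hcm : IsRegularCost c m c₀ c₁ a b L)
    [IsProbabilityMeasure μ] [IsProbabilityMeasure ν] (h : IsDualMaximizer c m μ ν φ ψ)
    (hex : ∀ y, ∃ x, φ x + ψ y * m x y = c x y)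
    (huniq : ∀ᵐ y ∂ν, ∀ x x', φ x + ψ y * m x y = c x y → φ x' + ψ y * m x' y = c x' y → x = x') :
    (∃ π, IsOptimalPlan c m μ ν π) ∧ ∃ S : Y → X, ∀ π, IsOptimalPlan c m μ ν π →
      IsInducedByDualMap m ν π S ∧ ∀ S' : Y → X, IsInducedByDualMap m ν π S' → S' =ᵐ[ν] S := by
  have hX : Nonempty X := nonempty_of_isProbabilityMeasure μ
  have hφ := h.continuous_left
  have hψ := h.continuous_right
  have hψ0 : ∫ y, ψ y ∂ν = 0 := h.integral_eq_zero hcm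
  have hmc : Continuous fun p : X × Y => m p.1 p.2 := hcm.continuous_mass
  obtain ⟨S, hS, hSF, hSu⟩ := exists_measurable_selection ν
    (F := {p : Y × X | φ p.2 + ψ p.1 * m p.2 p.1 = c p.2 p.1})
    ((isClosed_contact hcm hφ hψ).preimage continuous_swap) hex huniq
  have hψeq : ∀ y, infOver (fun y x => (c x y - φ x) / m x y) y = ψ y := fun y => by
    obtain ⟨x, hx⟩ := hex y
    refine le_antisymm ?_ (hcm.le_rightTransform hφ h.isFeasible y)
    refine (hcm.rightTransform_le hφ x y).trans_eq ?_
    rw [div_eq_iff (hcm.mass_pos x y).ne']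
    linarith
  have hmS := hcm.measurable_inv_mass hS
  set Z := ∫⁻ y, ENNReal.ofReal (1 / m (S y) y) ∂ν with hZ
  have hZ0 : Z ≠ 0 := hcm.lintegral_inv_mass_ne_zero S
  have hZt : Z ≠ ⊤ := hcm.lintegral_inv_mass_ne_top S
  set ρ := (ν.withDensity fun y => ENNReal.ofReal (1 / m (S y) y)).map S with hρ
  have hρfin : IsFiniteMeasure (ν.withDensity fun y => ENNReal.ofReal (1 / m (S y) y)) :=
    isFiniteMeasure_withDensity hZt
  have hρuniv : ρ univ = Z := by
    rw [hρ, Measure.map_apply hS MeasurableSet.univ, preimage_univ,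
      withDensity_apply _ MeasurableSet.univ, Measure.restrict_univ]
  -- First variation along `φ + s η` with `∫ η dμ = 0`. The value is unchanged, so a right transform
  -- with positive `ν`-integral would be slack that `integral_add_le` turns into a better pair.
  have hρμ : ρ = Z • μ := by
    rw [← hρuniv]
    refine eq_smul_of_integral_nonneg μ ρ fun η hη hη0 => ?_
    rw [hρ, integral_map hS.aemeasurable hη.aestronglyMeasurable,
      integral_withDensity_eq_integral_toReal_smul hmS (by simp)]
    have hD := integral_nonneg_of_integral_infOver_le ν (hcm.continuous_right hφ)
      (B := fun y x => η x / m x y)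
      ((hη.comp continuous_snd).div (hmc.comp continuous_swap)
        fun p => (hcm.mass_pos p.2 p.1).ne') (T := S) ?_ fun s hs => ?_
    · refine hD.trans_eq (integral_congr_ae (ae_of_all _ fun y => ?_))
      simp only [smul_eq_mul]
      rw [ENNReal.toReal_ofReal (one_div_pos.2 (hcm.mass_pos _ _)).le, one_div_mul_eq_div]
    · filter_upwards [hSu] with y hy x hx
      rw [hψeq, div_eq_iff (hcm.mass_pos x y).ne'] at hx
      exact hy x (show φ x + ψ y * m x y = c x y by linarith)
    · simp only [hψeq]
      have hsη : Continuous fun x => φ x + s * η x := by fun_prop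
      have hfun : infOver (fun y x => (c x y - φ x) / m x y - s * (η x / m x y)) =
          rightTransform c m fun x => φ x + s * η x := by
        unfold rightTransform
        congr 1
        ext y x
        have := (hcm.mass_pos x y).ne'
        field_simp
        ring
      rw [hfun, hψ0]
      by_contra! hpos
      have hle := h.integral_add_le hcm hsη (hcm.continuous_rightTransform hsη)
        (hcm.isFeasible_rightTransform hsη) hpos.le
      rw [integral_add (integrable_of_continuous μ hφ)
        (integrable_of_continuous μ (by fun_prop)), integral_const_mul, hη0] at hle
      linarith [mul_pos hcm.pos hpos]
  have hgraph : Measurable fun y => (S y, y) := hS.prodMk measurable_id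
  set π₀ := (dualSource m ν S).map fun y => (S y, y) with hπ₀
  have hπ₀prob : IsProbabilityMeasure π₀ :=
    have : IsProbabilityMeasure (dualSource m ν S) := ⟨hcm.dualSource_univ S⟩
    Measure.isProbabilityMeasure_map hgraph.aemeasurable
  have hplan : IsPlan m μ ν π₀ := by
    refine IsPlan.of_map hcm (r := Z⁻¹) ?_ ?_
    · rw [hπ₀, Measure.map_map measurable_fst hgraph]
      change (dualSource m ν S).map S = μ
      rw [dualSource, Measure.map_smul, ← hρ, hρμ, smul_smul, ENNReal.inv_mul_cancel hZ0 hZt,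
        one_smul]
    · rw [hπ₀, withDensity_map_eq _ hgraph hcm.measurable_mass,
        Measure.map_map measurable_snd hgraph, hcm.withDensity_dualSource hS]
      exact Measure.map_id
  have hae : ∀ᵐ p ∂π₀, φ p.1 + ψ p.2 * m p.1 p.2 = c p.1 p.2 := by
    rw [hπ₀, ae_map_iff hgraph.aemeasurable (isClosed_contact hcm hφ hψ).measurableSet]
    refine Measure.AbsolutelyContinuous.ae_le ?_ hSF
    exact (Measure.smul_absolutelyContinuous).trans (withDensity_absolutelyContinuous _ _)
  refine ⟨⟨π₀, hplan.isOptimalPlan hcm hφ hψ h.isFeasible hψ0 hae⟩, S, fun π hπ => ?_⟩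
  have := hπ.isPlan.isProbabilityMeasure
  have hcon := hπ.ae_contact hcm hplan hφ hψ h.isFeasible hψ0 hae
  set M := ∫⁻ p, ENNReal.ofReal (m p.1 p.2) ∂π with hM
  -- Uniqueness of contact points is known `ν`-almost everywhere, and it is `m π`, not `π`, whose
  -- second marginal is proportional to `ν`. So the graph property is proved for `σ`, and the
  -- density is divided out afterwards.
  set σ := π.withDensity fun p => ENNReal.ofReal (m p.1 p.2) with hσ
  have hσν : σ.map Prod.snd = M • ν := hπ.isPlan.map_snd_withDensity hcm
  have hσcon : ∀ᵐ p ∂σ, φ p.1 + ψ p.2 * m p.1 p.2 = c p.1 p.2 :=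
    (withDensity_absolutelyContinuous _ _).ae_le hcon
  have hSσ : ∀ᵐ p ∂σ, ∀ z, φ z + ψ p.2 * m z p.2 = c z p.2 → z = S p.2 := by
    refine ae_of_ae_map measurable_snd.aemeasurable
      (p := fun y => ∀ z, φ z + ψ y * m z y = c z y → z = S y) ?_
    rw [hσν]
    exact Measure.smul_absolutelyContinuous.ae_le hSu
  have hσeq : σ = (M • ν).map fun y => (S y, y) := by
    have hsw := eq_map_of_ae_eq (π := σ.map Prod.swap) (κ := M • ν)
      (by rw [Measure.map_map measurable_fst measurable_swap]; exact hσν) hS ?_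
    · have := congrArg (Measure.map Prod.swap) hsw
      rw [Measure.map_map measurable_swap measurable_swap,
        Measure.map_map measurable_swap (by fun_prop)] at this
      rw [Prod.swap_swap_eq, Measure.map_id] at this
      exact this
    · refine (ae_map_iff measurable_swap.aemeasurable
        (measurableSet_eq_fun measurable_snd (hS.comp measurable_fst))).2 ?_
      filter_upwards [hσcon, hSσ] with p h₁ h₂ using h₂ _ h₁
  have hπσ : π = σ.withDensity fun p => (ENNReal.ofReal (m p.1 p.2))⁻¹ :=
    (withDensity_inv_same hcm.measurable_mass
      (ae_of_all _ fun p => (ENNReal.ofReal_pos.2 (hcm.mass_pos _ _)).ne')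
      (ae_of_all _ fun p => ENNReal.ofReal_ne_top)).symm
  have hinv : Measurable fun p : X × Y => (ENNReal.ofReal (m p.1 p.2))⁻¹ :=
    hcm.measurable_mass.inv
  have hπeq : π = M • (ν.withDensity fun y => ENNReal.ofReal (1 / m (S y) y)).map
      fun y => (S y, y) := by
    rw [hπσ, hσeq, withDensity_map_eq _ hgraph hinv, withDensity_smul_measure,
      Measure.map_smul]
    simp only [hcm.ofReal_inv_mass]
  have hMZ : M = Z⁻¹ := by
    have h₁ := congrArg (fun κ => κ univ) hπeq
    simp only [measure_univ, Measure.smul_apply, smul_eq_mul] at h₁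
    rw [Measure.map_apply hgraph MeasurableSet.univ, preimage_univ,
      withDensity_apply _ MeasurableSet.univ, Measure.restrict_univ] at h₁
    exact ENNReal.eq_inv_of_mul_eq_one_left h₁.symm
  have hind : π = (dualSource m ν S).map fun y => (S y, y) := by
    rw [dualSource, Measure.map_smul, ← hZ, ← hMZ]
    exact hπeq
  refine ⟨⟨hS, hind⟩, fun S' hS' => ?_⟩
  have hgraph' : Measurable fun y => (S' y, y) := hS'.1.prodMk measurable_id
  have heq := congrArg (Measure.map Prod.swap) (hind.symm.trans hS'.2)
  rw [Measure.map_map measurable_swap hgraph, Measure.map_map measurable_swap hgraph'] at heq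
  -- The source measures of `S` and `S'` may differ a priori; equality holds almost everywhere for
  -- that of `S'`, which dominates `ν`.
  exact (hcm.absolutelyContinuous_dualSource hS'.1).ae_le (ae_eq_of_map_eq hS hS'.1 heq)

end PlanLemmas
-- Differentiability and radial functions touching from above
section Radial

/-- A Lipschitz function on a set with null boundary is differentiable at almost every point, for
every absolutely continuous measure. -/
theorem exists_extension_ae_differentiableAt {E : Type*} [NormedAddCommGroup E] [NormedSpace ℝ E]
    [FiniteDimensional ℝ E] [MeasureSpace E] [BorelSpace E]
    [(volume : Measure E).IsAddHaarMeasure] {X : Set E} {μ : Measure X}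
    (hμ : μ.map Subtype.val ≪ (volume : Measure E)) (hX : volume (frontier X) = 0)
    {φ : X → ℝ} {L : ℝ≥0} (hφ : LipschitzWith L φ) :
    ∃ f : E → ℝ, (∀ x : X, f x = φ x) ∧
      ∀ᵐ x : X ∂μ, DifferentiableAt ℝ f x ∧ X ∈ 𝓝 (x : E) := by
  have hval : ∀ x : X, Function.extend Subtype.val φ 0 (x : E) = φ x :=
    fun x => Subtype.val_injective.extend_apply φ 0 x
  refine ⟨Function.extend Subtype.val φ 0, hval, ?_⟩
  have hlip : LipschitzOnWith L (Function.extend Subtype.val φ 0) X := fun x hx x' hx' => by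
    have h₁ := hval ⟨x, hx⟩
    have h₂ := hval ⟨x', hx'⟩
    simp only at h₁ h₂
    rw [h₁, h₂]
    exact hφ ⟨x, hx⟩ ⟨x', hx'⟩
  have h₁ : ∀ᵐ x ∂(volume : Measure E),
      x ∈ X → DifferentiableWithinAt ℝ (Function.extend Subtype.val φ 0) X x :=
    hlip.ae_differentiableWithinAt_of_mem
  have h₂ : ∀ᵐ x ∂(volume : Measure E), x ∉ frontier X := measure_eq_zero_iff_ae_notMem.1 hX
  filter_upwards [ae_of_ae_map measurable_subtype_coe.aemeasurable (hμ.ae_le h₁),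
    ae_of_ae_map measurable_subtype_coe.aemeasurable (hμ.ae_le h₂)] with x hx₁ hx₂
  have hint : X ∈ 𝓝 (x : E) := by
    rw [← mem_interior_iff_mem_nhds, ← self_sdiff_frontier]
    exact ⟨x.2, hx₂⟩
  exact ⟨(hx₁ x.2).differentiableAt hint, hint⟩

variable {E : Type*} [NormedAddCommGroup E] [InnerProductSpace ℝ E]

theorem hasFDerivAt_norm_sub {x y : E} (hxy : x ≠ y) :
    HasFDerivAt (fun x' => ‖x' - y‖) (‖x - y‖⁻¹ • innerSL ℝ (x - y)) x := by
  have hne : ‖x - y‖ ≠ 0 := norm_ne_zero_iff.2 (sub_ne_zero.2 hxy)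
  have h₁ := ((hasStrictFDerivAt_norm_sq (x - y)).hasFDerivAt.comp x
    ((hasFDerivAt_id x).sub_const y)).sqrt (by simpa using hne)
  convert h₁ using 1
  · ext x'
    simp [Real.sqrt_sq]
  · ext v
    simp [Real.sqrt_sq]
    field_simp

/-- The norm is not smooth at its centre, but `G r - G 0 = o(r)` absorbs the singularity. -/
theorem hasFDerivAt_radial_zero {G : ℝ → ℝ} (hG : HasDerivWithinAt G 0 (Ioi 0) 0) (y : E) :
    HasFDerivAt (fun x' => G ‖x' - y‖) (0 : E →L[ℝ] ℝ) y := by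
  have h₁ := (hasDerivWithinAt_iff_isLittleO.1 hG.Ici_of_Ioi)
  have h₂ : Tendsto (fun x' : E => ‖x' - y‖) (𝓝 y) (𝓝[Ici 0] 0) := by
    refine tendsto_nhdsWithin_iff.2 ⟨?_, Eventually.of_forall fun x' => norm_nonneg _⟩
    have : Continuous fun x' : E => ‖x' - y‖ := by fun_prop
    simpa using this.tendsto y
  rw [hasFDerivAt_iff_isLittleO]
  have h₃ := h₁.comp_tendsto h₂
  simp only [Function.comp_def, sub_zero, smul_zero] at h₃
  simpa using h₃.norm_right

/-- The differential of `f` at a point where a radial function touches it from above. -/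
theorem fderiv_eq_of_radial_touching {f : E → ℝ} {x y : E} (hf : DifferentiableAt ℝ f x)
    {G : ℝ → ℝ} {p : ℝ} (hle : ∀ᶠ x' in 𝓝 x, f x' ≤ G ‖x' - y‖) (heq : f x = G ‖x - y‖)
    (hG : x ≠ y → HasDerivAt G p ‖x - y‖) (hG0 : HasDerivWithinAt G 0 (Ioi 0) 0) :
    (x = y → fderiv ℝ f x = 0) ∧
      (x ≠ y → fderiv ℝ f x = (p * ‖x - y‖⁻¹) • innerSL ℝ (x - y)) := by
  have key : ∀ g' : E →L[ℝ] ℝ, HasFDerivAt (fun x' => G ‖x' - y‖) g' x → fderiv ℝ f x = g' := by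
    intro g' hg'
    have hmax : IsLocalMax (fun x' => f x' - G ‖x' - y‖) x := by
      filter_upwards [hle] with x' hx'
      linarith
    exact sub_eq_zero.1 (hmax.hasFDerivAt_eq_zero (hf.hasFDerivAt.sub hg'))
  refine ⟨fun hxy => key 0 ?_, fun hxy => key _ ?_⟩
  · subst hxy
    exact hasFDerivAt_radial_zero hG0 x
  · have := (hG hxy).comp_hasFDerivAt x (hasFDerivAt_norm_sub hxy)
    rwa [smul_smul] at this

/-- Two radial functions with a common strictly monotone, positive profile for the derivatives
cannot touch `f` from above at the same point of differentiability, unless their centres agree. -/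
theorem eq_of_radial_touching {f : E → ℝ} {x : E} (hf : DifferentiableAt ℝ f x) {P : ℝ → ℝ}
    {s : Set ℝ} (hP : StrictMonoOn P s) (hPpos : ∀ r ∈ s, 0 < P r) {C : Set E}
    (hC : ∀ y ∈ C, ∃ G : ℝ → ℝ, (∀ᶠ x' in 𝓝 x, f x' ≤ G ‖x' - y‖) ∧ f x = G ‖x - y‖ ∧
      HasDerivWithinAt G 0 (Ioi 0) 0 ∧
      (x ≠ y → HasDerivAt G (P ‖x - y‖) ‖x - y‖ ∧ ‖x - y‖ ∈ s))
    {y y' : E} (hy : y ∈ C) (hy' : y' ∈ C) : y = y' := by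
  have key : ∀ y ∈ C, (x = y → fderiv ℝ f x = 0) ∧ (x ≠ y → ‖x - y‖ ∈ s ∧
      fderiv ℝ f x = (P ‖x - y‖ * ‖x - y‖⁻¹) • innerSL ℝ (x - y) ∧
      ‖fderiv ℝ f x‖ = P ‖x - y‖) := by
    intro y hy
    obtain ⟨G, h₁, h₂, h₃, h₄⟩ := hC y hy
    obtain ⟨h₅, h₆⟩ := fderiv_eq_of_radial_touching hf h₁ h₂ (fun h => (h₄ h).1) h₃
    refine ⟨h₅, fun hxy => ⟨(h₄ hxy).2, h₆ hxy, ?_⟩⟩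
    have hne : ‖x - y‖ ≠ 0 := norm_ne_zero_iff.2 (sub_ne_zero.2 hxy)
    rw [h₆ hxy, norm_smul, innerSL_apply_norm, norm_mul, norm_inv, norm_norm,
      Real.norm_of_nonneg (hPpos _ (h₄ hxy).2).le, mul_assoc, inv_mul_cancel₀ hne, mul_one]
  -- A centre at `x` forces a zero differential, while any other centre forces a differential of
  -- norm `P > 0`.
  have hzero : ∀ y ∈ C, ∀ y' ∈ C, x = y → x = y' := fun y hy y' hy' hxy => by
    by_contra hxy'
    obtain ⟨hs, -, hn⟩ := (key y' hy').2 hxy'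
    rw [(key y hy).1 hxy, norm_zero] at hn
    exact (hPpos _ hs).ne hn
  by_cases hxy : x = y
  · exact hxy.symm.trans (hzero y hy y' hy' hxy)
  · have hxy' : x ≠ y' := fun h => hxy (hzero y' hy' y hy h)
    obtain ⟨hs, hd, hn⟩ := (key y hy).2 hxy
    obtain ⟨hs', hd', hn'⟩ := (key y' hy').2 hxy'
    -- The norm of the differential gives the distance; after that its direction gives the centre.
    have hr : ‖x - y‖ = ‖x - y'‖ := hP.injOn hs hs' (hn.symm.trans hn')
    rw [hd, ← hr] at hd'
    have hne : P ‖x - y‖ * ‖x - y‖⁻¹ ≠ 0 :=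
      mul_ne_zero (hPpos _ hs).ne' (inv_ne_zero (norm_ne_zero_iff.2 (sub_ne_zero.2 hxy)))
    have hin : innerSL ℝ (x - y) = innerSL ℝ (x - y') := smul_right_injective _ hne hd'
    have hsub : x - y = x - y' := by
      refine ext_inner_right ℝ fun v => ?_
      exact congrArg (fun l => l v) hin
    exact sub_right_injective hsub

end Radial

/-! ### Monotone profiles and uniqueness of contact points -/

section Profile

/-- The properties of the radial profiles `h` and `d` on `(0, R]` that the uniqueness of contact
points rests on. -/
structure IsProfilePair (h d : ℝ → ℝ) (ε R : ℝ) : Prop where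
  eps_pos : 0 < ε
  differentiable_cost : ∀ z, 0 < z → DifferentiableAt ℝ h z
  differentiable_decay : ∀ z, 0 < z → DifferentiableAt ℝ d z
  deriv_cost_zero : HasDerivWithinAt h 0 (Ioi 0) 0
  deriv_decay_zero : HasDerivWithinAt d 0 (Ioi 0) 0
  monotone_cost : MonotoneOn h (Ici 0)
  monotone_decay : MonotoneOn d (Ici 0)
  deriv_monotone : MonotoneOn (deriv d) (Ioi 0)
  deriv_nonneg : ∀ z, 0 < z → 0 ≤ deriv d z
  strictMono : StrictMonoOn (fun z => deriv h z - ε * deriv d z) (Ioc 0 R)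
  pos : ∀ z ∈ Ioc 0 R, 0 < deriv h z - ε * deriv d z

theorem IsProfilePair.of_convex {h d : ℝ → ℝ} {ε R : ℝ} (hε : 0 < ε)
    (hh : ContDiffOn ℝ ∞ h (Ici 0)) (hd : ContDiffOn ℝ ∞ d (Ici 0))
    (hd_convex : ConvexOn ℝ (Ici 0) d)
    (hh_mono : MonotoneOn h (Ici 0)) (hd_mono : MonotoneOn d (Ici 0))
    (hh_zero : Tendsto (fun t => (h t - h 0) / t) (𝓝[>] 0) (𝓝 0))
    (hd_zero : Tendsto (fun t => (d t - d 0) / t) (𝓝[>] 0) (𝓝 0))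
    (hdom : ∀ z : ℝ, 0 < z → z ≤ R →
      ε * deriv (deriv d) z < deriv (deriv h) z ∧ ε * deriv d z < deriv h z) :
    IsProfilePair h d ε R := by
  have hslope : ∀ {g : ℝ → ℝ}, Tendsto (fun t => (g t - g 0) / t) (𝓝[>] 0) (𝓝 0) →
      HasDerivWithinAt g 0 (Ioi 0) 0 := fun {g} hg => by
    rw [hasDerivWithinAt_iff_tendsto_slope' (by simp)]
    refine hg.congr fun t => ?_
    simp [slope_def_field]
  have hIoi : Ioi (0 : ℝ) ⊆ Ici 0 := Ioi_subset_Ici_self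
  have hderiv : ∀ {g : ℝ → ℝ}, ContDiffOn ℝ ∞ g (Ici 0) →
      (∀ z, 0 < z → DifferentiableAt ℝ g z) ∧ ∀ z, 0 < z → DifferentiableAt ℝ (deriv g) z := by
    intro g hg
    have h₁ := hg.mono hIoi
    have h₂ : ContDiffOn ℝ 1 (deriv g) (Ioi 0) :=
      (h₁.deriv_of_isOpen (m := ∞) isOpen_Ioi (by simp)).of_le (by simp)
    exact ⟨fun z hz => (h₁.differentiableOn (by simp)).differentiableAt (Ioi_mem_nhds hz),
      fun z hz => (h₂.differentiableOn (by simp)).differentiableAt (Ioi_mem_nhds hz)⟩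
  obtain ⟨hh₁, hh₂⟩ := hderiv hh
  obtain ⟨hd₁, hd₂⟩ := hderiv hd
  refine ⟨hε, hh₁, hd₁, hslope hh_zero, hslope hd_zero, hh_mono, hd_mono,
    (hd_convex.subset hIoi (convex_Ioi 0)).monotoneOn_deriv hd₁, fun z hz => ?_, ?_, fun z hz => ?_⟩
  · rw [← (hd₁ z hz).derivWithin (isOpen_Ioi.uniqueDiffWithinAt hz)]
    exact (hd_mono.mono hIoi).derivWithin_nonneg
  · refine strictMonoOn_of_deriv_pos (convex_Ioc 0 R) (fun z hz => ?_) fun z hz => ?_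
    · exact ((hh₂ z hz.1).continuousAt.sub
        (continuousAt_const.mul (hd₂ z hz.1).continuousAt)).continuousWithinAt
    · rw [interior_Ioc] at hz
      rw [deriv_fun_sub (hh₂ z hz.1) ((hd₂ z hz.1).const_mul ε), deriv_const_mul _ (hd₂ z hz.1)]
      exact sub_pos.2 (hdom z hz.1 hz.2.le).1
  · exact sub_pos.2 (hdom z hz.1 hz.2).2

variable {h d : ℝ → ℝ} {ε R : ℝ} (hp : IsProfilePair h d ε R)
include hp

namespace IsProfilePair

/-- Write the profile as `(h' - ε d') + d' (ε + k (h - t))`: a strictly increasing term plus a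
product of nonnegative nondecreasing factors. In the application `t = φ x`. -/
theorem strictMonoOn_source {k : ℝ} (hk : 0 ≤ k) (t : ℝ) :
    StrictMonoOn (fun r => deriv h r + k * deriv d r * (h r - t))
      {r ∈ Ioc 0 R | 0 ≤ ε + k * (h r - t)} := by
  intro r hr r' hr' hlt
  have h₁ := hp.strictMono hr.1 hr'.1 hlt
  have h₂ := hp.deriv_monotone hr.1.1 hr'.1.1 hlt.le
  have h₃ := hp.monotone_cost hr.1.1.le hr'.1.1.le hlt.le
  have h₄ : deriv d r * (ε + k * (h r - t)) ≤ deriv d r' * (ε + k * (h r' - t)) :=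
    mul_le_mul h₂ (by nlinarith) hr.2 (hp.deriv_nonneg _ hr'.1.1)
  simp only at h₁ ⊢
  linarith

theorem pos_source {k t r : ℝ} (hr : r ∈ {r ∈ Ioc 0 R | 0 ≤ ε + k * (h r - t)}) :
    0 < deriv h r + k * deriv d r * (h r - t) := by
  have h₁ := hp.pos r hr.1
  have h₂ := mul_nonneg (hp.deriv_nonneg r hr.1.1) hr.2
  linarith

/-- Here the splitting is `(h' - ε d') e^{kd} + d' (ε e^{kd} + k t)`, applied with `t = ψ y`. -/
theorem strictMonoOn_target {k : ℝ} (hk : 0 ≤ k) (t : ℝ) :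
    StrictMonoOn (fun r => deriv h r * Real.exp (k * d r) + k * deriv d r * t)
      {r ∈ Ioc 0 R | 0 ≤ ε * Real.exp (k * d r) + k * t} := by
  intro r hr r' hr' hlt
  have h₁ := hp.strictMono hr.1 hr'.1 hlt
  have h₂ := hp.deriv_monotone hr.1.1 hr'.1.1 hlt.le
  have h₃ : Real.exp (k * d r) ≤ Real.exp (k * d r') :=
    Real.exp_le_exp.2 (mul_le_mul_of_nonneg_left
      (hp.monotone_decay hr.1.1.le hr'.1.1.le hlt.le) hk)
  have h₄ : deriv d r * (ε * Real.exp (k * d r) + k * t) ≤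
      deriv d r' * (ε * Real.exp (k * d r') + k * t) :=
    mul_le_mul h₂ (by nlinarith [hp.eps_pos]) hr.2 (hp.deriv_nonneg _ hr'.1.1)
  have h₅ : (deriv h r - ε * deriv d r) * Real.exp (k * d r) <
      (deriv h r' - ε * deriv d r') * Real.exp (k * d r') :=
    mul_lt_mul h₁ h₃ (Real.exp_pos _) (hp.pos r' hr'.1).le
  simp only
  linarith

theorem pos_target {k t r : ℝ} (hr : r ∈ {r ∈ Ioc 0 R | 0 ≤ ε * Real.exp (k * d r) + k * t}) :
    0 < deriv h r * Real.exp (k * d r) + k * deriv d r * t := by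
  have h₁ := mul_pos (hp.pos r hr.1) (Real.exp_pos (k * d r))
  have h₂ := mul_nonneg (hp.deriv_nonneg r hr.1.1) hr.2
  linarith

variable {n : ℕ} {X Y : Set (EuclideanSpace ℝ (Fin n))}
  (hR : ∀ x ∈ X, ∀ y ∈ Y, ‖x - y‖ ≤ R) {k : ℝ} (hk : 0 ≤ k) {φ : X → ℝ} {ψ : Y → ℝ}
  (hf : IsFeasible (radialCost X Y h) (expMassChange X Y d k) φ ψ)
  (hlow : ∀ x y, -ε ≤ k * (ψ y * expMassChange X Y d k x y))
include hR hk hf hlow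

/-- Equality at a contact point replaces `ψ y * m` by `h r - φ x`, so all contact points of `x`
share one derivative profile; `hlow` puts their distances in the set where it is strictly
increasing. -/
theorem ae_contact_unique_left {μ : Measure X}
    (hμ : μ.map Subtype.val ≪ (volume : Measure (EuclideanSpace ℝ (Fin n))))
    (hX : volume (frontier X) = 0) {L : ℝ≥0} (hφ : LipschitzWith L φ) :
    ∀ᵐ x ∂μ, ∀ y y', φ x + ψ y * expMassChange X Y d k x y = radialCost X Y h x y →
      φ x + ψ y' * expMassChange X Y d k x y' = radialCost X Y h x y' → y = y' := by
  obtain ⟨f, hfφ, hae⟩ := exists_extension_ae_differentiableAt hμ hX hφ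
  filter_upwards [hae] with x hx y₁ y₂ hy₁ hy₂
  refine Subtype.ext (eq_of_radial_touching hx.1 (hp.strictMonoOn_source hk (φ x))
    (fun r hr => hp.pos_source hr)
    (C := {z | ∃ y : Y, (y : EuclideanSpace ℝ (Fin n)) = z ∧
      φ x + ψ y * expMassChange X Y d k x y = radialCost X Y h x y}) ?_
    ⟨y₁, rfl, hy₁⟩ ⟨y₂, rfl, hy₂⟩)
  rintro _ ⟨y, rfl, hy⟩
  have hlow' := hlow x y
  unfold expMassChange radialCost at hy
  unfold expMassChange at hlow'
  refine ⟨fun r => h r - ψ y * Real.exp (-k * d r), ?_, ?_, ?_, fun hxy => ⟨?_, ⟨?_, ?_⟩, ?_⟩⟩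
  · filter_upwards [hx.2] with x' hx'
    have h₁ := hf ⟨x', hx'⟩ y
    have h₂ := hfφ ⟨x', hx'⟩
    simp only [expMassChange, radialCost] at h₁ h₂
    rw [h₂]
    linarith
  · rw [hfφ]
    linarith
  · have := hp.deriv_cost_zero.fun_sub (((hp.deriv_decay_zero.const_mul (-k)).exp).const_mul (ψ y))
    simpa using this
  · have hpos : 0 < ‖(x : EuclideanSpace ℝ (Fin n)) - y‖ := norm_pos_iff.2 (sub_ne_zero.2 hxy)
    have := (hp.differentiable_cost _ hpos).hasDerivAt.fun_sub
      ((((hp.differentiable_decay _ hpos).hasDerivAt.const_mul (-k)).exp).const_mul (ψ y))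
    refine this.congr_deriv ?_
    rw [← hy]
    ring
  · exact norm_pos_iff.2 (sub_ne_zero.2 hxy)
  · exact hR x x.2 y y.2
  · rw [← hy, add_sub_cancel_left]
    linarith

/-- Solving the constraint for `ψ` gives the touching function `(h r - φ x) e^{k d r}`. At a contact
point its value is `ψ y`, which eliminates `φ x` from its derivative. -/
theorem ae_contact_unique_right {ν : Measure Y}
    (hν : ν.map Subtype.val ≪ (volume : Measure (EuclideanSpace ℝ (Fin n))))
    (hY : volume (frontier Y) = 0) {L : ℝ≥0} (hψ : LipschitzWith L ψ) :
    ∀ᵐ y ∂ν, ∀ x x', φ x + ψ y * expMassChange X Y d k x y = radialCost X Y h x y →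
      φ x' + ψ y * expMassChange X Y d k x' y = radialCost X Y h x' y → x = x' := by
  obtain ⟨f, hfψ, hae⟩ := exists_extension_ae_differentiableAt hν hY hψ
  filter_upwards [hae] with y hy x₁ x₂ hx₁ hx₂
  refine Subtype.ext (eq_of_radial_touching hy.1 (hp.strictMonoOn_target hk (ψ y))
    (fun r hr => hp.pos_target hr)
    (C := {z | ∃ x : X, (x : EuclideanSpace ℝ (Fin n)) = z ∧
      φ x + ψ y * expMassChange X Y d k x y = radialCost X Y h x y}) ?_
    ⟨x₁, rfl, hx₁⟩ ⟨x₂, rfl, hx₂⟩)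
  rintro _ ⟨x, rfl, hx⟩
  have hlow' := hlow x y
  unfold expMassChange radialCost at hx
  unfold expMassChange at hlow'
  rw [norm_sub_rev] at hx hlow'
  have hexp : ∀ t, Real.exp (-k * t) * Real.exp (k * t) = 1 := fun t => by
    rw [← Real.exp_add]
    simp
  have hψy : ψ y = (h ‖(y : EuclideanSpace ℝ (Fin n)) - x‖ - φ x) *
      Real.exp (k * d ‖(y : EuclideanSpace ℝ (Fin n)) - x‖) := by
    rw [← hx, add_sub_cancel_left, mul_assoc, hexp, mul_one]
  refine ⟨fun r => (h r - φ x) * Real.exp (k * d r), ?_, ?_, ?_, fun hxy => ⟨?_, ⟨?_, ?_⟩, ?_⟩⟩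
  · filter_upwards [hy.2] with y' hy'
    have h₁ := hf x ⟨y', hy'⟩
    have h₂ := hfψ ⟨y', hy'⟩
    simp only [expMassChange, radialCost] at h₁ h₂
    rw [norm_sub_rev] at h₁
    rw [h₂]
    have h₃ := mul_le_mul_of_nonneg_right (le_sub_iff_add_le'.2 h₁)
      (Real.exp_pos (k * d ‖y' - (x : EuclideanSpace ℝ (Fin n))‖)).le
    rwa [mul_assoc, hexp, mul_one] at h₃
  · rw [hfψ]
    exact hψy
  · have := (hp.deriv_cost_zero.sub_const (φ x)).fun_mul ((hp.deriv_decay_zero.const_mul k).exp)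
    simpa using this
  · have hpos : 0 < ‖(y : EuclideanSpace ℝ (Fin n)) - x‖ := norm_pos_iff.2 (sub_ne_zero.2 hxy)
    have := ((hp.differentiable_cost _ hpos).hasDerivAt.sub_const (φ x)).fun_mul
      (((hp.differentiable_decay _ hpos).hasDerivAt.const_mul k).exp)
    refine this.congr_deriv ?_
    rw [hψy]
    ring
  · exact norm_pos_iff.2 (sub_ne_zero.2 hxy)
  · rw [norm_sub_rev]
    exact hR x x.2 y y.2
  · have h₁ := mul_nonneg (neg_le_iff_add_nonneg.1 hlow')
      (Real.exp_pos (k * d ‖(y : EuclideanSpace ℝ (Fin n)) - x‖)).le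
    have h₂ := hexp (d ‖(y : EuclideanSpace ℝ (Fin n)) - x‖)
    rw [add_mul, mul_assoc k, mul_assoc (ψ y), h₂, mul_one] at h₁
    linarith

end IsProfilePair

end Profile
-- Uniform bounds for the radial cost and mass-change factor
section Regularity

theorem abs_exp_sub_exp_le {u v M : ℝ} (hu : u ≤ M) (hv : v ≤ M) :
    |Real.exp u - Real.exp v| ≤ Real.exp M * |u - v| := by
  wlog huv : v ≤ u generalizing u v
  · rw [abs_sub_comm, abs_sub_comm u]
    exact this hv hu (le_of_not_ge huv)
  rw [abs_of_nonneg (sub_nonneg.2 (Real.exp_le_exp.2 huv)), abs_of_nonneg (sub_nonneg.2 huv)]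
  have h₁ := Real.add_one_le_exp (v - u)
  have h₂ : Real.exp v = Real.exp u * Real.exp (v - u) := by rw [← Real.exp_add]; ring_nf
  have h₃ : Real.exp u - Real.exp v ≤ Real.exp u * (u - v) := by
    rw [h₂]
    nlinarith [Real.exp_pos u]
  exact h₃.trans (mul_le_mul_of_nonneg_right (Real.exp_le_exp.2 hu) (sub_nonneg.2 huv))

variable {n : ℕ} {X Y : Set (EuclideanSpace ℝ (Fin n))} {h d : ℝ → ℝ} {R : ℝ}

/-- The restriction `k ≤ 1` makes all constants independent of `k`, so the threshold for `k` can be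
chosen from them without circularity. -/
theorem isRegularCost_radial (hR : ∀ x ∈ X, ∀ y ∈ Y, ‖x - y‖ ≤ R) (hR0 : 0 ≤ R)
    (hh_mono : MonotoneOn h (Ici 0)) (hd_mono : MonotoneOn d (Ici 0)) {Lh Ld : ℝ≥0}
    (hh : LipschitzOnWith Lh h (Ici 0)) (hd : LipschitzOnWith Ld d (Ici 0))
    {k : ℝ} (hk : 0 ≤ k) (hk1 : k ≤ 1) :
    IsRegularCost (radialCost X Y h) (expMassChange X Y d k) (h 0) (h R)
      (Real.exp (-|d R|)) (Real.exp |d 0|) (Lh + Real.exp |d 0| * Ld) := by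
  have hdist : Continuous fun p : X × Y => ‖(p.1 : EuclideanSpace ℝ (Fin n)) - p.2‖ := by fun_prop
  have hmem : ∀ z : EuclideanSpace ℝ (Fin n), ‖z‖ ∈ Ici (0 : ℝ) := fun z => norm_nonneg z
  have hle : ∀ (x : X) (y : Y), ‖(x : EuclideanSpace ℝ (Fin n)) - y‖ ≤ R :=
    fun x y => hR x x.2 y y.2
  have hcost : ∀ z z' : EuclideanSpace ℝ (Fin n), |h ‖z‖ - h ‖z'‖| ≤ Lh * dist z z' :=
    fun z z' => by
      have h₁ := hh.dist_le_mul _ (hmem z) _ (hmem z')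
      rw [Real.dist_eq, Real.dist_eq] at h₁
      refine h₁.trans (mul_le_mul_of_nonneg_left ?_ Lh.2)
      rw [dist_eq_norm]
      exact abs_norm_sub_norm_le z z'
  have hupper : ∀ z : EuclideanSpace ℝ (Fin n), -k * d ‖z‖ ≤ |d 0| := fun z => by
    have h₁ := hd_mono (mem_Ici.2 le_rfl) (hmem z) (norm_nonneg z)
    have h₂ := mul_le_mul_of_nonneg_left h₁ hk
    have h₃ := mul_le_mul_of_nonneg_left (neg_abs_le (d 0)) hk
    have h₄ := mul_le_mul_of_nonneg_right hk1 (abs_nonneg (d 0))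
    linarith
  have hmass : ∀ z z' : EuclideanSpace ℝ (Fin n),
      |Real.exp (-k * d ‖z‖) - Real.exp (-k * d ‖z'‖)| ≤ Real.exp |d 0| * Ld * dist z z' :=
    fun z z' => by
      refine (abs_exp_sub_exp_le (hupper z) (hupper z')).trans ?_
      rw [mul_assoc]
      refine mul_le_mul_of_nonneg_left ?_ (Real.exp_pos _).le
      have h₁ := hd.dist_le_mul _ (hmem z) _ (hmem z')
      rw [Real.dist_eq, Real.dist_eq] at h₁
      have h₂ : |-k * d ‖z‖ - -k * d ‖z'‖| = k * |d ‖z‖ - d ‖z'‖| := by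
        rw [← mul_sub, abs_mul, abs_neg, abs_of_nonneg hk]
      have h₃ : |‖z‖ - ‖z'‖| ≤ dist z z' := by
        rw [dist_eq_norm]
        exact abs_norm_sub_norm_le z z'
      rw [h₂]
      calc k * |d ‖z‖ - d ‖z'‖| ≤ 1 * |d ‖z‖ - d ‖z'‖| :=
            mul_le_mul_of_nonneg_right hk1 (abs_nonneg _)
        _ ≤ Ld * dist z z' := by
            rw [one_mul]
            exact h₁.trans (mul_le_mul_of_nonneg_left h₃ Ld.2)
  have hLd : 0 ≤ Real.exp |d 0| * Ld := mul_nonneg (Real.exp_pos _).le Ld.2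
  have hcost' : ∀ z z' : EuclideanSpace ℝ (Fin n),
      |h ‖z‖ - h ‖z'‖| ≤ (Lh + Real.exp |d 0| * Ld) * dist z z' := fun z z' =>
    (hcost z z').trans (mul_le_mul_of_nonneg_right (by linarith) dist_nonneg)
  have hmass' : ∀ z z' : EuclideanSpace ℝ (Fin n),
      |Real.exp (-k * d ‖z‖) - Real.exp (-k * d ‖z'‖)| ≤
        (Lh + Real.exp |d 0| * Ld) * dist z z' := fun z z' =>
    (hmass z z').trans (mul_le_mul_of_nonneg_right (le_add_of_nonneg_left Lh.2) dist_nonneg)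
  have hleft : ∀ (x x' : X) (y : Y), dist ((x : EuclideanSpace ℝ (Fin n)) - y) (x' - y) =
      dist x x' := fun x x' y => dist_sub_right _ _ _
  have hright : ∀ (x : X) (y y' : Y), dist ((x : EuclideanSpace ℝ (Fin n)) - y) (x - y') =
      dist y y' := fun x y y' => dist_sub_left _ _ _
  refine ⟨?_, ?_, fun x y => ?_, fun x y => ?_, Real.exp_pos _, fun x y => ?_, fun x y => ?_,
    add_nonneg Lh.2 hLd, fun x x' y => ?_, fun x y y' => ?_, fun x x' y => ?_, fun x y y' => ?_⟩
  · exact hh.continuousOn.comp_continuous hdist fun p => hmem _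
  · have := hd.continuousOn.comp_continuous hdist fun p => hmem _
    exact Real.continuous_exp.comp (continuous_const.mul this)
  · exact hh_mono (mem_Ici.2 le_rfl) (hmem _) (norm_nonneg _)
  · exact hh_mono (hmem _) (mem_Ici.2 hR0) (hle x y)
  · refine Real.exp_le_exp.2 ?_
    have h₁ := mul_le_mul_of_nonneg_left (hd_mono (hmem _) (mem_Ici.2 hR0) (hle x y)) hk
    have h₂ := mul_le_mul_of_nonneg_left (le_abs_self (d R)) hk
    have h₃ := mul_le_mul_of_nonneg_right hk1 (abs_nonneg (d R))
    linarith
  · exact Real.exp_le_exp.2 (hupper _)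
  · rw [← hleft x x' y]
    exact hcost' _ _
  · rw [← hright x y y']
    exact hcost' _ _
  · rw [← hleft x x' y]
    exact hmass' _ _
  · rw [← hright x y y']
    exact hmass' _ _

theorem norm_sub_le_sSup (hX : IsCompact X) (hY : IsCompact Y) {x y : EuclideanSpace ℝ (Fin n)}
    (hx : x ∈ X) (hy : y ∈ Y) : ‖x - y‖ ≤ sSup {r : ℝ | ∃ x ∈ X, ∃ y ∈ Y, r = ‖x - y‖} := by
  refine le_csSup ?_ ⟨x, hx, y, hy, rfl⟩
  obtain ⟨A, hA⟩ := hX.isBounded.exists_norm_le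
  obtain ⟨B, hB⟩ := hY.isBounded.exists_norm_le
  refine ⟨A + B, ?_⟩
  rintro _ ⟨x, hx, y, hy, rfl⟩
  exact (norm_sub_le x y).trans (add_le_add (hA x hx) (hB y hy))

end Regularity

end NonConservativeOT

theorem mainTheorem4 (n : ℕ) (X Y : Set (EuclideanSpace ℝ (Fin n)))
    (hXcompact : IsCompact X) (hXconn : IsConnected X) (hXint : closure (interior X) = X)
    (hYcompact : IsCompact Y) (hYconn : IsConnected Y) (hYint : closure (interior Y) = Y)
    (h d : ℝ → ℝ)
    (hh_smooth : ContDiffOn ℝ ∞ h (Ici 0)) (hd_smooth : ContDiffOn ℝ ∞ d (Ici 0))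
    (hh_convex : ConvexOn ℝ (Ici 0) h) (hd_convex : ConvexOn ℝ (Ici 0) d)
    (hh_lip : ∃ L : ℝ≥0, LipschitzOnWith L h (Ici 0))
    (hd_lip : ∃ L : ℝ≥0, LipschitzOnWith L d (Ici 0))
    (hh_mono : StrictMonoOn h (Ici 0))
    (hh_zero : Tendsto (fun t => (h t - h 0) / t) (𝓝[>] 0) (𝓝 0))
    (hd_mono : MonotoneOn d (Ici 0))
    (hd_zero : Tendsto (fun t => (d t - d 0) / t) (𝓝[>] 0) (𝓝 0))
    (ε : ℝ) (hε : 0 < ε)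
    (hdom : ∀ z : ℝ, 0 < z → z ≤ sSup {r : ℝ | ∃ x ∈ X, ∃ y ∈ Y, r = ‖x - y‖} →
      ε * deriv (deriv d) z < deriv (deriv h) z ∧ ε * deriv d z < deriv h z) :
    ∃ K : ℝ, 0 < K ∧ ∀ k : ℝ, 0 ≤ k → k < K →
      ∀ (μ : Measure X) (ν : Measure Y) [IsProbabilityMeasure μ] [IsProbabilityMeasure ν],
        (μ.map Subtype.val ≪ (volume : Measure (EuclideanSpace ℝ (Fin n))) →
          volume (frontier X) = 0 →
          (∃ π, NonConservativeOT.IsOptimalPlan (NonConservativeOT.radialCost X Y h)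
            (NonConservativeOT.expMassChange X Y d k) μ ν π) ∧
          ∃ T : X → Y, ∀ π, NonConservativeOT.IsOptimalPlan (NonConservativeOT.radialCost X Y h)
              (NonConservativeOT.expMassChange X Y d k) μ ν π →
            NonConservativeOT.IsInducedByMap μ π T ∧
            ∀ T' : X → Y, NonConservativeOT.IsInducedByMap μ π T' → T' =ᵐ[μ] T) ∧
        (ν.map Subtype.val ≪ (volume : Measure (EuclideanSpace ℝ (Fin n))) →
          volume (frontier Y) = 0 →
          (∃ π, NonConservativeOT.IsOptimalPlan (NonConservativeOT.radialCost X Y h)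
            (NonConservativeOT.expMassChange X Y d k) μ ν π) ∧
          ∃ S : Y → X, ∀ π, NonConservativeOT.IsOptimalPlan (NonConservativeOT.radialCost X Y h)
              (NonConservativeOT.expMassChange X Y d k) μ ν π →
            NonConservativeOT.IsInducedByDualMap (NonConservativeOT.expMassChange X Y d k) ν π S ∧
            ∀ S' : Y → X,
              NonConservativeOT.IsInducedByDualMap (NonConservativeOT.expMassChange X Y d k) ν π S' →
              S' =ᵐ[ν] S) := by
  obtain ⟨Lh, hLh⟩ := hh_lip
  obtain ⟨Ld, hLd⟩ := hd_lip
  set R := sSup {r : ℝ | ∃ x ∈ X, ∃ y ∈ Y, r = ‖x - y‖} with hRdef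
  have hR : ∀ x ∈ X, ∀ y ∈ Y, ‖x - y‖ ≤ R :=
    fun x hx y hy => NonConservativeOT.norm_sub_le_sSup hXcompact hYcompact hx hy
  obtain ⟨x₀, hx₀⟩ := hXconn.nonempty
  obtain ⟨y₀, hy₀⟩ := hYconn.nonempty
  have hR0 : 0 ≤ R := (norm_nonneg _).trans (hR x₀ hx₀ y₀ hy₀)
  have hp : NonConservativeOT.IsProfilePair h d ε R :=
    NonConservativeOT.IsProfilePair.of_convex hε hh_smooth hd_smooth hd_convex hh_mono.monotoneOn
      hd_mono hh_zero hd_zero hdom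
  have : CompactSpace X := isCompact_iff_compactSpace.1 hXcompact
  have : CompactSpace Y := isCompact_iff_compactSpace.1 hYcompact
  set C := (h R - h 0) / Real.exp (-|d R|) with hC
  have hC0 : 0 ≤ C := div_nonneg (sub_nonneg.2 (hh_mono.monotoneOn (mem_Ici.2 le_rfl)
    (mem_Ici.2 hR0) hR0)) (Real.exp_pos _).le
  have hCb : 0 < C * Real.exp |d 0| + 1 := by positivity
  -- `C` bounds `|ψ|` and `exp |d 0|` bounds `m`, so this threshold gives `k |ψ| m ≤ ε`. The `+ 1`
  -- keeps the denominator positive when `C = 0`.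
  refine ⟨min 1 (ε / (C * Real.exp |d 0| + 1)), lt_min one_pos (div_pos hε hCb),
    fun k hk hkK μ ν _ _ => ?_⟩
  have hcm := NonConservativeOT.isRegularCost_radial hR hR0 hh_mono.monotoneOn hd_mono hLh hLd hk
    (hkK.trans_le (min_le_left _ _)).le
  obtain ⟨φ, ψ, hmax, hψC, ⟨Lφ, hLφ⟩, ⟨Lψ, hLψ⟩, hex₁, hex₂⟩ := hcm.exists_isDualMaximizer μ ν
  have hlow : ∀ x y, -ε ≤ k * (ψ y * NonConservativeOT.expMassChange X Y d k x y) := by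
    intro x y
    have h₁ : -(C * Real.exp |d 0|) ≤ ψ y * NonConservativeOT.expMassChange X Y d k x y := by
      refine (abs_le.1 ?_).1
      rw [abs_mul, abs_of_pos (hcm.mass_pos x y)]
      exact mul_le_mul (hψC y) (hcm.mass_le x y) (hcm.mass_pos x y).le hC0
    have h₂ := mul_le_mul_of_nonneg_left h₁ hk
    have h₃ := hkK.trans_le (min_le_right _ _)
    rw [lt_div_iff₀ hCb] at h₃
    linarith
  exact ⟨fun hμ hfr => hmax.exists_optimal_map hcm hex₁
      (hp.ae_contact_unique_left hR hk hmax.isFeasible hlow hμ hfr hLφ),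
    fun hν hfr => hmax.exists_optimal_dual_map hcm hex₂
      (hp.ae_contact_unique_right hR hk hmax.isFeasible hlow hν hfr hLψ)⟩
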